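/- Let $A$ be a small Reedy category, with direct subcategory $A^{\to}$ and inverse subcategory $A^{\gets}$: there are a degree function from the objects of $A$ to an ordinal that is strictly raised by the nonidentity morphisms of $A^{\to}$ and strictly lowered by the nonidentity morphisms of $A^{\gets}$, and every morphism of $A$ factors uniquely as a morphism of $A^{\gets}$ followed by a morphism of $A^{\to}$. Let $(\mathbf{M},\otimes,\mathbf{1},\mathrm{MOR})$ be a complete and cocomplete, locally small symmetric monoidal model category (closed symmetric monoidal, with internal Hom $\mathrm{MOR}$, satisfying the pushout-product axiom and the unit axiom). Write $\mathbf{M}(A)$ for the category of functors $A^{\mathrm{op}}\to\mathbf{M}$ and $\mathbf{M}(A\times A)$ for the category of functors $A^{\mathrm{op}}\times A^{\mathrm{op}}\to\mathbf{M}$. Equip them with the Reedy model structures, where $A^{\mathrm{op}}$ is a Reedy category with $(A^{\mathrm{op}})^{\to}=(A^{\gets})^{\mathrm{op}}$ and $(A^{\mathrm{op}})^{\gets}=(A^{\to})^{\mathrm{op}}$, and where a morphism of the product $A^{\mathrm{op}}\times A^{\mathrm{op}}$ is direct (respectively, inverse) if both its components are. Thus the weak equivalences are the objectwise ones, and a morphism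 $X\to Y$ is a cofibration (respectively, a fibration) if and only if each relative latching map $X_c\sqcup^{L_cX}L_cY\to Y_c$ is a cofibration of $\mathbf{M}$ (respectively, each relative matching map $X_c\to M^cX\times_{M^cY}Y_c$ is a fibration of $\mathbf{M}$). For $\alpha$ in $A$ let $y_{\mathbf{M}}(\alpha)\in\mathbf{M}(A)$ be the presheaf $\beta\mapsto\coprod_{A(\beta,\alpha)}\mathbf{1}$, and for $U,F\in\mathbf{M}(A\times A)$ put $\mathrm{MOR}^{\mathbf{M}}_{\mathbf{M}(A\times A)}(U,F)=\int_{(\alpha,\alpha')}\mathrm{MOR}(U_{(\alpha,\alpha')},F_{(\alpha,\alpha')})$. For $X,Y\in\mathbf{M}(A)$ and $F\in\mathbf{M}(A\times A)$ define \[(X\boxtimes Y)_{(\alpha,\alpha')}=X_\alpha\otimes Y_{\alpha'},\] \[\mathrm{MOR}_\boxtimes(Y,F)_\alpha=\mathrm{MOR}^{\mathbf{M}}_{\mathbf{M}(A\times A)}(y_{\mathbf{M}}(\alpha)\boxtimes Y,F),\qquad \mathrm{mor}_\boxtimes(X,F)_\alpha=\mathrm{MOR}^{\mathbf{M}}_{\mathbf{M}(A\times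 A)}(X\boxtimes y_{\mathbf{M}}(\alpha),F).\] Then $(\boxtimes,\mathrm{MOR}_\boxtimes,\mathrm{mor}_\boxtimes)$ is a Quillen adjunction of two variables $\mathbf{M}(A)\times\mathbf{M}(A)\to\mathbf{M}(A\times A)$ for the Reedy model structures. That is, there are isomorphisms, natural in $X$, $Y$ and $F$, \[\mathrm{Hom}(X,\mathrm{MOR}_\boxtimes(Y,F))\cong\mathrm{Hom}(X\boxtimes Y,F)\cong\mathrm{Hom}(Y,\mathrm{mor}_\boxtimes(X,F)),\] and for any Reedy cofibrations $i\colon X\to X'$ and $j\colon Y\to Y'$ of $\mathbf{M}(A)$ the pushout-product \[(X'\boxtimes Y)\sqcup^{X\boxtimes Y}(X\boxtimes Y')\to X'\boxtimes Y'\] is a Reedy cofibration of $\mathbf{M}(A\times A)$, which is a weak equivalence if $i$ or $j$ is. -/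

import Mathlib

open CategoryTheory CategoryTheory.Limits Opposite HomotopicalAlgebra MonoidalCategory

universe w v u v₁ v₂ v₃ u₁ u₂ u₃

noncomputable section

/-! ### Products of Reedy categories -/

namespace HomotopicalAlgebra.ReedyStructure

section Product

variable {C₁ : Type u₁} [Category.{v₁} C₁] {C₂ : Type u₂} [Category.{v₂} C₂]

instance prod_isMultiplicative (W : MorphismProperty C₁) (W' : MorphismProperty C₂)
    [W.IsMultiplicative] [W'.IsMultiplicative] : (W.prod W').IsMultiplicative where
  id_mem _ := ⟨W.id_mem _, W'.id_mem _⟩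
  comp_mem _ _ hf hg := ⟨W.comp_mem _ _ hf.1 hg.1, W'.comp_mem _ _ hf.2 hg.2⟩

theorem prod_identities {X Y : C₁ × C₂} (f : X ⟶ Y)
    (h₁ : MorphismProperty.identities C₁ f.1) (h₂ : MorphismProperty.identities C₂ f.2) :
    MorphismProperty.identities (C₁ × C₂) f := by
  obtain ⟨X₁, X₂⟩ := X
  obtain ⟨Y₁, Y₂⟩ := Y
  obtain ⟨f₁, f₂⟩ := f
  dsimp at h₁ h₂
  cases h₁
  cases h₂
  exact ⟨(X₁, X₂)⟩

/-- The factorizations of a morphism of `C₁ × C₂` are the pairs of factorizations of its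
two components. -/
def prodFactorizationEquiv {W₁ W₂ : MorphismProperty C₁} {W₁' W₂' : MorphismProperty C₂}
    {X Y : C₁ × C₂} (f : X ⟶ Y) :
    (W₁.prod W₁').MapFactorizationData (W₂.prod W₂') f ≃
      W₁.MapFactorizationData W₂ f.1 × W₁'.MapFactorizationData W₂' f.2 where
  toFun d :=
    (⟨d.Z.1, d.i.1, d.p.1, congrArg (fun g => g.1) d.fac, d.hi.1, d.hp.1⟩,
      ⟨d.Z.2, d.i.2, d.p.2, congrArg (fun g => g.2) d.fac, d.hi.2, d.hp.2⟩)
  invFun d :=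
    ⟨(d.1.Z, d.2.Z), (d.1.i, d.2.i), (d.1.p, d.2.p),
      Prod.ext d.1.fac d.2.fac, ⟨d.1.hi, d.2.hi⟩, ⟨d.1.hp, d.2.hp⟩⟩
  left_inv _ := rfl
  right_inv _ := rfl

/-- The product of two Reedy categories: a morphism of `C₁ × C₂` is inverse (resp. direct) if
and only if both of its components are so. The degree of a pair of objects is the ordinal rank
of the pair of their degrees, for the product order. -/
def prod {W₁ W₂ : MorphismProperty C₁} [W₁.IsMultiplicative] [W₂.IsMultiplicative]
    {W₁' W₂' : MorphismProperty C₂} [W₁'.IsMultiplicative] [W₂'.IsMultiplicative]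
    {α β : Type w} [LinearOrder α] [OrderBot α] [SuccOrder α] [WellFoundedLT α]
    [LinearOrder β] [OrderBot β] [SuccOrder β] [WellFoundedLT β]
    (r : ReedyStructure W₁ W₂ α) (r' : ReedyStructure W₁' W₂' β) :
    ReedyStructure (W₁.prod W₁') (W₂.prod W₂') Ordinal.{w} where
  deg c := IsWellFounded.rank (fun x y : α × β => x < y) (r.deg c.1, r'.deg c.2)
  lt₁ {X Y} f hf hf' := by
    apply IsWellFounded.rank_lt_of_rel
    by_cases h₁ : MorphismProperty.identities C₁ f.1
    · by_cases h₂ : MorphismProperty.identities C₂ f.2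
      · exact (hf' (prod_identities f h₁ h₂)).elim
      · exact Prod.lt_iff.2 (Or.inr ⟨r.le₁ _ hf.1, r'.lt₁ _ hf.2 h₂⟩)
    · exact Prod.lt_iff.2 (Or.inl ⟨r.lt₁ _ hf.1 h₁, r'.le₁ _ hf.2⟩)
  lt₂ {X Y} f hf hf' := by
    apply IsWellFounded.rank_lt_of_rel
    by_cases h₁ : MorphismProperty.identities C₁ f.1
    · by_cases h₂ : MorphismProperty.identities C₂ f.2
      · exact (hf' (prod_identities f h₁ h₂)).elim
      · exact Prod.lt_iff.2 (Or.inr ⟨r.le₂ _ hf.1, r'.lt₂ _ hf.2 h₂⟩)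
    · exact Prod.lt_iff.2 (Or.inl ⟨r.lt₂ _ hf.1 h₁, r'.le₂ _ hf.2⟩)
  nonempty_unique f := by
    obtain ⟨h₁⟩ := r.nonempty_unique f.1
    obtain ⟨h₂⟩ := r'.nonempty_unique f.2
    exact ⟨(prodFactorizationEquiv f).symm.uniqueCongr
      { default := (h₁.default, h₂.default)
        uniq := fun d => Prod.ext (h₁.uniq d.1) (h₂.uniq d.2) }⟩

end Product

end HomotopicalAlgebra.ReedyStructure

namespace ReedyExterior

/-! ### Latching and matching objects -/

section LatchingMatching

variable {C : Type v} [SmallCategory C] (P : MorphismProperty C) [P.IsMultiplicative] (c : C)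
variable {M : Type u} [Category.{v} M]

/-- The latching category at `c`, where `P` is the class of direct morphisms: the full
subcategory of the slice over `c` of the lluf subcategory `P` which consists of the morphisms
to `c` which are not identities. -/
structure LatchingCategory : Type v where
  left : C
  hom : left ⟶ c
  prop : P hom
  not_identity : ¬ MorphismProperty.identities C hom

instance : SmallCategory (LatchingCategory P c) where
  Hom f g := { h : f.left ⟶ g.left // P h ∧ h ≫ g.hom = f.hom }
  id f := ⟨𝟙 f.left, P.id_mem _, Category.id_comp _⟩
  comp h k := ⟨h.1 ≫ k.1, P.comp_mem _ _ h.2.1 k.2.1, by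
    rw [Category.assoc, k.2.2, h.2.2]⟩
  id_comp _ := Subtype.ext (Category.id_comp _)
  comp_id _ := Subtype.ext (Category.comp_id _)
  assoc _ _ _ := Subtype.ext (Category.assoc _ _ _)

/-- The forgetful functor from the latching category. -/
abbrev latchingForget : LatchingCategory P c ⥤ C where
  obj f := f.left
  map h := h.1
  map_id _ := rfl
  map_comp _ _ := rfl

/-- The matching category at `c`, where `P` is the class of inverse morphisms: the full
subcategory of the slice under `c` of the lluf subcategory `P` which consists of the morphisms
from `c` which are not identities. -/
structure MatchingCategory : Type v where
  right : C
  hom : c ⟶ right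
  prop : P hom
  not_identity : ¬ MorphismProperty.identities C hom

instance : SmallCategory (MatchingCategory P c) where
  Hom f g := { h : f.right ⟶ g.right // P h ∧ f.hom ≫ h = g.hom }
  id f := ⟨𝟙 f.right, P.id_mem _, Category.comp_id _⟩
  comp h k := ⟨h.1 ≫ k.1, P.comp_mem _ _ h.2.1 k.2.1, by
    rw [← Category.assoc, h.2.2, k.2.2]⟩
  id_comp _ := Subtype.ext (Category.id_comp _)
  comp_id _ := Subtype.ext (Category.comp_id _)
  assoc _ _ _ := Subtype.ext (Category.assoc _ _ _)

/-- The forgetful functor from the matching category. -/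
abbrev matchingForget : MatchingCategory P c ⥤ C where
  obj f := f.right
  map h := h.1
  map_id _ := rfl
  map_comp _ _ := rfl

section Latching

variable [HasColimits M]

/-- The latching object `L_c X`. -/
abbrev latchingObj (X : C ⥤ M) : M := colimit (latchingForget P c ⋙ X)

/-- The morphism `L_c X ⟶ L_c Y` induced by `φ : X ⟶ Y`. -/
def latchingObjHom {X Y : C ⥤ M} (φ : X ⟶ Y) : latchingObj P c X ⟶ latchingObj P c Y :=
  colimMap (Functor.whiskerLeft (latchingForget P c) φ)

/-- The canonical morphism `L_c X ⟶ X_c`. -/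
def latchingMap (X : C ⥤ M) : latchingObj P c X ⟶ X.obj c :=
  colimit.desc (latchingForget P c ⋙ X)
    { pt := X.obj c
      ι :=
        { app := fun f => X.map f.hom
          naturality := fun f g h => by
            change X.map h.1 ≫ X.map g.hom = X.map f.hom ≫ 𝟙 _
            rw [← X.map_comp, h.2.2, Category.comp_id] } }

theorem ι_latchingMap (X : C ⥤ M) (f : LatchingCategory P c) :
    colimit.ι (latchingForget P c ⋙ X) f ≫ latchingMap P c X = X.map f.hom :=
  colimit.ι_desc _ f

theorem ι_latchingObjHom {X Y : C ⥤ M} (φ : X ⟶ Y) (f : LatchingCategory P c) :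
    colimit.ι (latchingForget P c ⋙ X) f ≫ latchingObjHom P c φ =
      φ.app f.left ≫ colimit.ι (latchingForget P c ⋙ Y) f :=
  ι_colimMap _ f

theorem latchingMap_naturality {X Y : C ⥤ M} (φ : X ⟶ Y) :
    latchingMap P c X ≫ φ.app c = latchingObjHom P c φ ≫ latchingMap P c Y := by
  refine colimit.hom_ext fun f => ?_
  rw [← Category.assoc, ← Category.assoc, ι_latchingMap, ι_latchingObjHom, Category.assoc,
    ι_latchingMap, φ.naturality]

/-- The relative latching map `X_c ⨿_{L_c X} L_c Y ⟶ Y_c`. -/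
def relativeLatchingMap {X Y : C ⥤ M} (φ : X ⟶ Y) :
    pushout (latchingMap P c X) (latchingObjHom P c φ) ⟶ Y.obj c :=
  pushout.desc (φ.app c) (latchingMap P c Y) (latchingMap_naturality P c φ)

end Latching

section Matching

variable [HasLimits M]

/-- The matching object `M^c X`. -/
abbrev matchingObj (X : C ⥤ M) : M := limit (matchingForget P c ⋙ X)

/-- The morphism `M^c X ⟶ M^c Y` induced by `φ : X ⟶ Y`. -/
def matchingObjHom {X Y : C ⥤ M} (φ : X ⟶ Y) : matchingObj P c X ⟶ matchingObj P c Y :=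
  limMap (Functor.whiskerLeft (matchingForget P c) φ)

/-- The canonical morphism `X_c ⟶ M^c X`. -/
def matchingMap (X : C ⥤ M) : X.obj c ⟶ matchingObj P c X :=
  limit.lift (matchingForget P c ⋙ X)
    { pt := X.obj c
      π :=
        { app := fun f => X.map f.hom
          naturality := fun f g h => by
            change 𝟙 _ ≫ X.map g.hom = X.map f.hom ≫ X.map h.1
            rw [← X.map_comp, h.2.2, Category.id_comp] } }

theorem matchingMap_π (X : C ⥤ M) (f : MatchingCategory P c) :
    matchingMap P c X ≫ limit.π (matchingForget P c ⋙ X) f = X.map f.hom :=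
  limit.lift_π _ f

theorem matchingObjHom_π {X Y : C ⥤ M} (φ : X ⟶ Y) (f : MatchingCategory P c) :
    matchingObjHom P c φ ≫ limit.π (matchingForget P c ⋙ Y) f =
      limit.π (matchingForget P c ⋙ X) f ≫ φ.app f.right :=
  limMap_π _ f

theorem matchingMap_naturality {X Y : C ⥤ M} (φ : X ⟶ Y) :
    matchingMap P c X ≫ matchingObjHom P c φ = φ.app c ≫ matchingMap P c Y := by
  refine limit.hom_ext fun f => ?_
  rw [Category.assoc, Category.assoc, matchingMap_π, matchingObjHom_π, ← Category.assoc,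
    matchingMap_π, φ.naturality]

/-- The relative matching map `X_c ⟶ M^c X ×_{M^c Y} Y_c`. -/
def relativeMatchingMap {X Y : C ⥤ M} (φ : X ⟶ Y) :
    X.obj c ⟶ pullback (matchingObjHom P c φ) (matchingMap P c Y) :=
  pullback.lift (matchingMap P c X) (φ.app c) (matchingMap_naturality P c φ)

end Matching

end LatchingMatching

/-! ### The Reedy model structure and Quillen adjunctions of two variables -/

/-- The three classes of morphisms of a model structure. -/
structure ModelClasses (C : Type u) [Category.{v} C] where
  /-- the weak equivalences -/
  weakEquivalences : MorphismProperty C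
  /-- the cofibrations -/
  cofibrations : MorphismProperty C
  /-- the fibrations -/
  fibrations : MorphismProperty C

/-- The three classes of morphisms of a model category. -/
def ModelClasses.ofModelCategory (M : Type u) [Category.{v} M] [ModelCategory M] :
    ModelClasses M where
  weakEquivalences := HomotopicalAlgebra.weakEquivalences M
  cofibrations := HomotopicalAlgebra.cofibrations M
  fibrations := HomotopicalAlgebra.fibrations M

/-- The Reedy model structure on the category of diagrams indexed by a Reedy category `C` with
inverse morphisms `W₁` and direct morphisms `W₂`, with values in a model category `M`. -/
def reedyModelClasses {C : Type v} [SmallCategory C] {W₁ W₂ : MorphismProperty C}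
    [W₁.IsMultiplicative] [W₂.IsMultiplicative]
    {α : Type w} [LinearOrder α] [OrderBot α] [SuccOrder α] [WellFoundedLT α]
    (_ : ReedyStructure W₁ W₂ α)
    (M : Type u) [Category.{v} M] [ModelCategory M] [HasLimits M] [HasColimits M] :
    ModelClasses (C ⥤ M) where
  weakEquivalences _ _ φ := ∀ c : C, WeakEquivalence (φ.app c)
  cofibrations _ _ φ := ∀ c : C, Cofibration (relativeLatchingMap W₂ c φ)
  fibrations _ _ φ := ∀ c : C, Fibration (relativeMatchingMap W₁ c φ)

section Quillen

variable {C₁ : Type u₁} [Category.{v₁} C₁] {C₂ : Type u₂} [Category.{v₂} C₂]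
  {C₃ : Type u₃} [Category.{v₃} C₃] [HasPushouts C₃]

/-- The pushout-product axiom for a bifunctor `F`: the pushout-product
`F(Y₁, X₂) ⨿_{F(X₁, X₂)} F(X₁, Y₂) ⟶ F(Y₁, Y₂)` of two cofibrations `f₁ : X₁ ⟶ Y₁` and
`f₂ : X₂ ⟶ Y₂` is a cofibration, which is trivial if either `f₁` or `f₂` is. -/
structure PushoutProductAxiom (m₁ : ModelClasses C₁) (m₂ : ModelClasses C₂)
    (m₃ : ModelClasses C₃) (F : C₁ ⥤ C₂ ⥤ C₃) : Prop where
  cofibration {X₁ Y₁ : C₁} (f₁ : X₁ ⟶ Y₁) {X₂ Y₂ : C₂} (f₂ : X₂ ⟶ Y₂)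
    (h₁ : m₁.cofibrations f₁) (h₂ : m₂.cofibrations f₂) :
    m₃.cofibrations (Functor.PushoutObjObj.ofHasPushout F f₁ f₂).ι
  weakEquivalence {X₁ Y₁ : C₁} (f₁ : X₁ ⟶ Y₁) {X₂ Y₂ : C₂} (f₂ : X₂ ⟶ Y₂)
    (h₁ : m₁.cofibrations f₁) (h₂ : m₂.cofibrations f₂)
    (h : m₁.weakEquivalences f₁ ∨ m₂.weakEquivalences f₂) :
    m₃.weakEquivalences (Functor.PushoutObjObj.ofHasPushout F f₁ f₂).ι

/-- `(F, G, H)` is a Quillen adjunction of two variables: there are isomorphisms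
`Hom(X₁, G(X₂, X₃)) ≅ Hom(F(X₁, X₂), X₃) ≅ Hom(X₂, H(X₁, X₃))`, natural in the three variables,
and `F` satisfies the pushout-product axiom. -/
structure IsQuillenAdjunctionOfTwoVariables (m₁ : ModelClasses C₁) (m₂ : ModelClasses C₂)
    (m₃ : ModelClasses C₃) (F : C₁ ⥤ C₂ ⥤ C₃) (G : C₂ᵒᵖ ⥤ C₃ ⥤ C₁) (H : C₁ᵒᵖ ⥤ C₃ ⥤ C₂) :
    Prop where
  adjunction₁ : Nonempty (F.flip ⊣₂ G)
  adjunction₂ : Nonempty (F ⊣₂ H)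
  pushoutProduct : PushoutProductAxiom m₁ m₂ m₃ F

end Quillen

/-- A model category with a closed symmetric monoidal structure is a symmetric monoidal model
category if the tensor product satisfies the pushout-product axiom and if the unit axiom holds:
for any cofibrant replacement `q : Q ⟶ 𝟙` of the unit and any cofibrant object `X`, the
morphism `Q ⊗ X ⟶ 𝟙 ⊗ X` is a weak equivalence. -/
structure IsSymmetricMonoidalModelCategory (M : Type u) [Category.{v} M] [MonoidalCategory M]
    [SymmetricCategory M] [MonoidalClosed M] [ModelCategory M] : Prop where
  pushoutProduct : PushoutProductAxiom (ModelClasses.ofModelCategory M)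
    (ModelClasses.ofModelCategory M) (ModelClasses.ofModelCategory M) (curriedTensor M)
  unit {Q X : M} (q : Q ⟶ 𝟙_ M) [IsCofibrant Q] [WeakEquivalence q] [IsCofibrant X] :
    WeakEquivalence (q ▷ X)

/-! ### The exterior tensor product and its two adjoints -/

section EnrichedHom

variable (J : Type v) [SmallCategory J] (M : Type u) [Category.{v} M] [MonoidalCategory M]
  [MonoidalClosed M]

/-- The bifunctor which sends `X` and `Y` to the functor `(j, j') ↦ MOR(X_j, Y_{j'})`, where
`MOR` is the internal Hom of `M`. -/
def internalHomDiagram : (J ⥤ M)ᵒᵖ ⥤ (J ⥤ M) ⥤ Jᵒᵖ ⥤ J ⥤ M :=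
  Functor.opHom J M ⋙ (Functor.whiskeringRight Jᵒᵖ Mᵒᵖ (M ⥤ M)).obj MonoidalClosed.internalHom ⋙
    (Functor.whiskeringLeft J M M ⋙ Functor.whiskeringRight Jᵒᵖ (M ⥤ M) (J ⥤ M)).flip

theorem internalHomDiagram_obj (X Y : J ⥤ M) (j j' : J) :
    ((((internalHomDiagram J M).obj (op X)).obj Y).obj (op j)).obj j' =
      (ihom (X.obj j)).obj (Y.obj j') := rfl

/-- The `M`-valued Hom of diagrams: the end `∫_j MOR(X_j, Y_j)`. -/
def enrichedHomFunctor [HasLimits M] : (J ⥤ M)ᵒᵖ ⥤ (J ⥤ M) ⥤ M :=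
  internalHomDiagram J M ⋙ (Functor.whiskeringRight _ _ _).obj (endFunctor J M)

theorem enrichedHomFunctor_obj [HasLimits M] (X Y : J ⥤ M) :
    ((enrichedHomFunctor J M).obj (op X)).obj Y =
      end_ (((internalHomDiagram J M).obj (op X)).obj Y) := rfl

end EnrichedHom

section Exterior

variable (A : Type v) [SmallCategory A] (M : Type u) [Category.{v} M] [MonoidalCategory M]

/-- The exterior tensor product `(X ⊠ Y)_{(α, α')} = X_α ⊗ Y_{α'}`. -/
def exteriorTensor : (Aᵒᵖ ⥤ M) ⥤ (Aᵒᵖ ⥤ M) ⥤ (Aᵒᵖ × Aᵒᵖ ⥤ M) :=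
  (Functor.postcompose₂.obj Functor.uncurry).obj (externalProductBifunctorCurried Aᵒᵖ Aᵒᵖ M)

theorem exteriorTensor_obj (X Y : Aᵒᵖ ⥤ M) (a : Aᵒᵖ × Aᵒᵖ) :
    (((exteriorTensor A M).obj X).obj Y).obj a = X.obj a.1 ⊗ Y.obj a.2 := rfl

/-- The functor `y_M : A ⥤ M(A)` which sends `α` to the presheaf `β ↦ Hom(β, α) · 𝟙`, the
coproduct of copies of the unit indexed by the set `Hom(β, α)`. -/
def yonedaUnit [HasColimits M] : A ⥤ (Aᵒᵖ ⥤ M) :=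
  yoneda ⋙ (Functor.whiskeringRight Aᵒᵖ (Type v) M).obj (sigmaConst.obj (𝟙_ M))

variable [MonoidalClosed M] [HasLimits M] [HasColimits M]

/-- The functor `MOR_⊠(Y, F)_α = MOR(y_M(α) ⊠ Y, F)`. -/
def exteriorMORLeft : (Aᵒᵖ ⥤ M)ᵒᵖ ⥤ (Aᵒᵖ × Aᵒᵖ ⥤ M) ⥤ (Aᵒᵖ ⥤ M) :=
  (yonedaUnit A M ⋙ exteriorTensor A M).flip.op ⋙ Functor.opHom _ _ ⋙
    (Functor.whiskeringRight _ _ _).obj (enrichedHomFunctor (Aᵒᵖ × Aᵒᵖ) M) ⋙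
      flipFunctor _ _ _

theorem exteriorMORLeft_obj (Y : Aᵒᵖ ⥤ M) (F : Aᵒᵖ × Aᵒᵖ ⥤ M) (a : A) :
    (((exteriorMORLeft A M).obj (op Y)).obj F).obj (op a) =
      ((enrichedHomFunctor (Aᵒᵖ × Aᵒᵖ) M).obj
        (op (((exteriorTensor A M).obj ((yonedaUnit A M).obj a)).obj Y))).obj F := rfl

/-- The functor `mor_⊠(X, F)_α = MOR(X ⊠ y_M(α), F)`. -/
def exteriorMORRight : (Aᵒᵖ ⥤ M)ᵒᵖ ⥤ (Aᵒᵖ × Aᵒᵖ ⥤ M) ⥤ (Aᵒᵖ ⥤ M) :=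
  (yonedaUnit A M ⋙ (exteriorTensor A M).flip).flip.op ⋙ Functor.opHom _ _ ⋙
    (Functor.whiskeringRight _ _ _).obj (enrichedHomFunctor (Aᵒᵖ × Aᵒᵖ) M) ⋙
      flipFunctor _ _ _

theorem exteriorMORRight_obj (X : Aᵒᵖ ⥤ M) (F : Aᵒᵖ × Aᵒᵖ ⥤ M) (a : A) :
    (((exteriorMORRight A M).obj (op X)).obj F).obj (op a) =
      ((enrichedHomFunctor (Aᵒᵖ × Aᵒᵖ) M).obj
        (op (((exteriorTensor A M).obj X).obj ((yonedaUnit A M).obj a)))).obj F := rfl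

end Exterior

end ReedyExterior

end

/-! The cofibration part rests on one observation about latching objects of a product. A nonidentity
direct morphism `(f, g)` into `(c₁, c₂)` factors through `(f, 𝟙)` or `(𝟙, g)`, and through both when
neither component is an identity. So the latching data of an exterior product at `(c₁, c₂)` are
glued from latching data in each variable, and the relative latching map of the pushout-product of
`i` and `j` behaves like the pushout-product in `M` of the relative latching maps of `i` at `c₁` and
`j` at `c₂`. No isomorphism of arrows is constructed: cofibrations are the maps with the left
lifting property against trivial fibrations, so it is enough to transfer lifting properties.
`exists_lift_of_pushoutProduct` does this on components, and the pushout-product axiom of `M`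
concludes.

For weak equivalences, which are objectwise, no latching object of the product is needed. A Reedy
cofibration is an objectwise cofibration (`cofibration_app_of_relativeLatchingMap`, by induction on
the degree), and the exterior pushout-product at `(c₁, c₂)` is the pushout-product of `i_{c₁}` and
`j_{c₂}`. The axiom of `M` therefore applies at each object.

The two adjunctions are one formal fact used twice. If `Φ(Y, X)` is the coend `∫^α K(Y, α) ⊗ X_α`,
then `Hom(Φ(Y, X), F) ≅ Hom(X, MOR(K(Y, -), F))`, by the tensor-hom adjunction and the universal
properties of ends and coends (`CoendPresentation.parametrizedAdjunction`). Co-Yoneda, `X_β = ∫^α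
y_M(α)_β ⊗ X_α`, is preserved by tensoring with a fixed object, since this is a left adjoint. Hence
`X ⊠ Y` has such a presentation in either variable, with weights `y_M(α) ⊠ Y` and `X ⊠ y_M(α)`. -/

namespace ReedyExterior

/-- Dependent choice along a transitive well-founded relation, where the choice at `i` is
constrained by the choices made at the predecessors of `i`. -/
theorem exists_family_of_wellFounded {ι : Type*} {r : ι → ι → Prop} (wf : WellFounded r)
    (tr : ∀ {i j k}, r i j → r j k → r i k) {T : ι → Type*}
    (R : ∀ i, (∀ j, r j i → T j) → T i → Prop)
    (h : ∀ i (t : ∀ j, r j i → T j),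
      (∀ j (hj : r j i), R j (fun k hk => t k (tr hk hj)) (t j hj)) → ∃ x, R i t x) :
    ∃ t : ∀ i, T i, ∀ i, R i (fun j _ => t j) (t i) := by
  classical
  -- The recursion cannot presuppose that earlier choices satisfy `R`, so it takes values in
  -- `Option`; `key` shows that the default `none` never occurs.
  let Φ : ∀ i, (∀ j, r j i → Option (T j)) → Option (T i) := fun i rec =>
    if H : ∃ x : T i, ∃ t : ∀ j, r j i → T j, (∀ j hj, rec j hj = some (t j hj)) ∧ R i t x then
      some H.choose else none
  let ℓ : ∀ i, Option (T i) := wf.fix Φ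
  have hℓ : ∀ i, ℓ i = Φ i (fun j _ => ℓ j) := fun i => wf.fix_eq Φ i
  have key : ∀ i, ∃ x : T i, ℓ i = some x ∧ ∃ t : ∀ j, r j i → T j,
      (∀ j hj, ℓ j = some (t j hj)) ∧ R i t x := by
    intro i
    induction i using wf.induction with
    | _ i ih =>
      choose t ht using ih
      have H : ∃ x : T i, ∃ t : ∀ j, r j i → T j,
          (∀ j (_ : r j i), ℓ j = some (t j ‹_›)) ∧ R i t x := by
        obtain ⟨x, hx⟩ := h i t (fun j hj => by
          obtain ⟨h₁, t', ht', hR⟩ := ht j hj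
          have : t' = fun k hk => t k (tr hk hj) := by
            funext k hk
            exact Option.some_injective _ ((ht' k hk).symm.trans (ht k (tr hk hj)).1)
          rwa [← this])
        exact ⟨x, t, fun j hj => (ht j hj).1, hx⟩
      exact ⟨H.choose, (hℓ i).trans (dif_pos H), H.choose_spec⟩
  choose t ht using key
  refine ⟨t, fun i => ?_⟩
  obtain ⟨h₁, t', ht', hR⟩ := ht i
  have : t' = fun j _ => t j := by
    funext j hj
    exact Option.some_injective _ ((ht' j hj).symm.trans (ht j).1)
  rwa [← this]

theorem eq_of_identities {C : Type*} [Category* C] {X Y : C} {f : X ⟶ Y}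
    (h : MorphismProperty.identities C f) : X = Y := by
  obtain ⟨⟩ := h
  rfl

/-! ### Lifting properties of latching objects; Reedy cofibrations are objectwise cofibrations -/

section Lifting

variable {C : Type v} [SmallCategory C] {P : MorphismProperty C} [P.IsMultiplicative]
  {α : Type w} [LinearOrder α] [WellFoundedLT α] {deg : C → α}
  {M : Type u} [Category.{v} M] [HasColimits M]

/-- The triangle over `c` identifies the structure maps once the comparison map is an identity. This
settles the identity case of cocone naturality, which recursion on the degree does not reach. -/
theorem LatchingCategory.eqToHom_of_identities {c : C} {g g' : LatchingCategory P c}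
    (h : g ⟶ g') (hh : MorphismProperty.identities C h.1) :
    ∃ e : g = g', h = eqToHom e := by
  obtain ⟨gl, gh, gp, gn⟩ := g
  obtain ⟨gl', gh', gp', gn'⟩ := g'
  obtain ⟨h, hP, hc⟩ := h
  dsimp at h hP hc hh ⊢
  obtain ⟨⟩ := hh
  obtain rfl : gh' = gh := by simpa using hc
  exact ⟨rfl, rfl⟩

/-- The composite of an object of the latching category at `f.left` with `f`. -/
abbrev LatchingCategory.comp
    (hdeg : ∀ {X Y : C} (f : X ⟶ Y), P f → ¬ MorphismProperty.identities C f → deg X < deg Y)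
    {c : C} (f : LatchingCategory P c) (g : LatchingCategory P f.left) :
    LatchingCategory P c where
  left := g.left
  hom := g.hom ≫ f.hom
  prop := P.comp_mem _ _ g.prop f.prop
  not_identity h := ((hdeg _ g.prop g.not_identity).trans (hdeg _ f.prop f.not_identity)).ne
    (congrArg deg (eq_of_identities h))

omit [WellFoundedLT α] in
theorem ι_comp
    (hdeg : ∀ {X Y : C} (f : X ⟶ Y), P f → ¬ MorphismProperty.identities C f → deg X < deg Y)
    {c : C} (X : C ⥤ M) (f : LatchingCategory P c) (g : LatchingCategory P f.left) :
    X.map g.hom ≫ colimit.ι (latchingForget P c ⋙ X) f =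
      colimit.ι (latchingForget P c ⋙ X) (f.comp hdeg g) :=
  colimit.w (latchingForget P c ⋙ X)
    (show f.comp hdeg g ⟶ f from ⟨g.hom, g.prop, rfl⟩)

/-- If the relative latching maps of `φ` have the left lifting property with respect to `p`,
then so do the morphisms between the latching objects. -/
theorem hasLiftingProperty_latchingObjHom
    (hdeg : ∀ {X Y : C} (f : X ⟶ Y), P f → ¬ MorphismProperty.identities C f → deg X < deg Y)
    {X Y : C ⥤ M} (φ : X ⟶ Y) {E B : M} (p : E ⟶ B)
    (hφ : ∀ d, HasLiftingProperty (relativeLatchingMap P d φ) p) (c : C) :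
    HasLiftingProperty (latchingObjHom P c φ) p := by
  refine ⟨fun {u v} sq => ?_⟩
  -- The lift `L_c Y ⟶ E` is built one component `Y_{f.left} ⟶ E` at a time, by recursion on the
  -- degree of `f.left`.
  let T (f : LatchingCategory P c) : Type v :=
    { x : Y.obj f.left ⟶ E //
      φ.app f.left ≫ x = colimit.ι (latchingForget P c ⋙ X) f ≫ u ∧
      x ≫ p = colimit.ι (latchingForget P c ⋙ Y) f ≫ v }
  have lt (f : LatchingCategory P c) (g : LatchingCategory P f.left) : deg g.left < deg f.left :=
    hdeg _ g.prop g.not_identity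
  obtain ⟨t, ht⟩ := exists_family_of_wellFounded
    (r := fun f g : LatchingCategory P c => deg f.left < deg g.left)
    (InvImage.wf (fun f : LatchingCategory P c => deg f.left) wellFounded_lt)
    (fun h h' => h.trans h') (T := T)
    (fun f t x => ∀ g : LatchingCategory P f.left,
      Y.map g.hom ≫ x.1 = (t (f.comp hdeg g) (lt f g)).1) (by
    intro f t ht
    -- The earlier choices, at the composites `g ≫ f`, form a cocone by their mutual compatibility;
    -- they prescribe the new component on the latching object at `f.left`.
    let a : latchingObj P f.left Y ⟶ E := colimit.desc (latchingForget P f.left ⋙ Y)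
      { pt := E
        ι :=
          { app := fun g => (t (f.comp hdeg g) (lt f g)).1
            naturality := fun g g' h => by
              change Y.map h.1 ≫ _ = _ ≫ 𝟙 _
              rw [Category.comp_id]
              by_cases hh : MorphismProperty.identities C h.1
              · obtain ⟨rfl, rfl⟩ := LatchingCategory.eqToHom_of_identities h hh
                exact (congrArg (· ≫ _) (Y.map_id _)).trans (Category.id_comp _)
              · have := ht (f.comp hdeg g') (lt f g') ⟨g.left, h.1, h.2.1, hh⟩
                refine this.trans ?_
                have e : (f.comp hdeg g').comp hdeg ⟨g.left, h.1, h.2.1, hh⟩ =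
                    f.comp hdeg g := by
                  dsimp [LatchingCategory.comp]
                  congr 1
                  rw [← Category.assoc, h.2.2]
                have : ∀ (k k' : LatchingCategory P c) (hk hk') (ek : k = k') ,
                    HEq (t k hk).1 (t k' hk').1 := by rintro k _ hk hk' rfl; rfl
                exact eq_of_heq (this _ _ _ _ e) } }
    have ha (g : LatchingCategory P f.left) :
        colimit.ι (latchingForget P f.left ⋙ Y) g ≫ a = (t (f.comp hdeg g) (lt f g)).1 :=
      colimit.ι_desc _ _
    -- Together with the value imposed by `u` on `X`, this is a lifting problem for the relative
    -- latching map at `f.left`; a solution is the next component.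
    let b : pushout (latchingMap P f.left X) (latchingObjHom P f.left φ) ⟶ E :=
      pushout.desc (colimit.ι (latchingForget P c ⋙ X) f ≫ u) a (by
        refine colimit.hom_ext fun g => ?_
        rw [← Category.assoc, ι_latchingMap,
          reassoc_of% (ι_latchingObjHom P f.left φ g), ha]
        refine Eq.trans ?_ (t (f.comp hdeg g) (lt f g)).2.1.symm
        rw [← ι_comp hdeg, Category.assoc])
    have sq' : CommSq b (relativeLatchingMap P f.left φ) p
        (colimit.ι (latchingForget P c ⋙ Y) f ≫ v) := ⟨by
      refine pushout.hom_ext ?_ ?_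
      · simp only [b, relativeLatchingMap, pushout.inl_desc_assoc, Category.assoc]
        rw [sq.w, ← Category.assoc, ι_latchingObjHom, Category.assoc]
      · simp only [b, relativeLatchingMap, pushout.inr_desc_assoc]
        refine colimit.hom_ext fun g => ?_
        rw [← Category.assoc, ha, (t _ _).2.2, ← Category.assoc, ι_latchingMap, ← Category.assoc,
          ι_comp hdeg]⟩
    have := hφ f.left
    refine ⟨⟨sq'.lift, ?_, sq'.fac_right⟩, fun g => ?_⟩
    · have := pushout.inl _ _ ≫= sq'.fac_left
      simpa only [b, relativeLatchingMap, pushout.inl_desc_assoc, pushout.inl_desc] using this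
    · have := colimit.ι (latchingForget P f.left ⋙ Y) g ≫= (pushout.inr _ _ ≫= sq'.fac_left)
      simp only [b, relativeLatchingMap, pushout.inr_desc_assoc, pushout.inr_desc] at this
      rwa [ha, ← Category.assoc, ι_latchingMap] at this)
  let l : latchingObj P c Y ⟶ E := colimit.desc (latchingForget P c ⋙ Y)
    { pt := E
      ι :=
        { app := fun f => (t f).1
          naturality := fun g f h => by
            change Y.map h.1 ≫ _ = _ ≫ 𝟙 _
            rw [Category.comp_id]
            by_cases hh : MorphismProperty.identities C h.1
            · obtain ⟨rfl, rfl⟩ := LatchingCategory.eqToHom_of_identities h hh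
              exact (congrArg (· ≫ _) (Y.map_id _)).trans (Category.id_comp _)
            · refine (ht f ⟨g.left, h.1, h.2.1, hh⟩).trans ?_
              have e : f.comp hdeg ⟨g.left, h.1, h.2.1, hh⟩ = g := by
                obtain ⟨gl, gh, gp, gn⟩ := g
                dsimp [LatchingCategory.comp]
                congr 1
                exact h.2.2
              have : ∀ (k k' : LatchingCategory P c) (ek : k = k') ,
                  HEq (t k).1 (t k').1 := by rintro k _ rfl; rfl
              exact eq_of_heq (this _ _ e) } }
  have hl (f : LatchingCategory P c) : colimit.ι (latchingForget P c ⋙ Y) f ≫ l = (t f).1 :=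
    colimit.ι_desc _ _
  exact ⟨⟨l, colimit.hom_ext fun f => by
      rw [← Category.assoc, ι_latchingObjHom, Category.assoc, hl, (t f).2.1],
    colimit.hom_ext fun f => by rw [← Category.assoc, hl, (t f).2.2]⟩⟩

variable [ModelCategory M]

/-- A Reedy cofibration is an objectwise cofibration. -/
theorem cofibration_app_of_relativeLatchingMap
    (hdeg : ∀ {X Y : C} (f : X ⟶ Y), P f → ¬ MorphismProperty.identities C f → deg X < deg Y)
    {X Y : C ⥤ M} (φ : X ⟶ Y) (hφ : ∀ d, Cofibration (relativeLatchingMap P d φ)) (c : C) :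
    Cofibration (φ.app c) := by
  -- `φ.app c` is a cobase change of this map followed by the relative latching map.
  have : Cofibration (latchingObjHom P c φ) := by
    rw [cofibration_iff, ← trivialFibrations_llp]
    intro E B p hp
    obtain ⟨_, _⟩ := (mem_trivialFibrations_iff p).1 hp
    exact hasLiftingProperty_latchingObjHom hdeg φ p (fun d => have := hφ d; inferInstance) c
  have := hφ c
  have : φ.app c = pushout.inl _ _ ≫ relativeLatchingMap P c φ := (pushout.inl_desc _ _ _).symm
  rw [this]
  infer_instance

end Lifting

/-! ### Maps out of the image of `X_c ⨿_{L_c X} L_c Y` under a left adjoint -/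

section LatchingDesc

variable {C : Type v} [SmallCategory C] (P : MorphismProperty C) [P.IsMultiplicative] {c : C}
  {M : Type u} [Category.{v} M] [HasColimits M] {N : Type u₁} [Category.{v₁} N]
  {X Y : C ⥤ M} (φ : X ⟶ Y) (G : M ⥤ N) [G.IsLeftAdjoint] {E : N}

variable {P φ} in
-- A left adjoint preserves the pushout and the latching colimit; transposing to the right adjoint
-- reduces the claim to their universal properties. It is applied with `G` a tensoring functor.
theorem latching_hom_ext
    {l l' : G.obj (pushout (latchingMap P c X) (latchingObjHom P c φ)) ⟶ E}
    (h₁ : G.map (pushout.inl _ _) ≫ l = G.map (pushout.inl _ _) ≫ l')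
    (h₂ : ∀ f : LatchingCategory P c,
      G.map (colimit.ι (latchingForget P c ⋙ Y) f ≫ pushout.inr _ _) ≫ l =
        G.map (colimit.ι (latchingForget P c ⋙ Y) f ≫ pushout.inr _ _) ≫ l') : l = l' := by
  apply ((Adjunction.ofIsLeftAdjoint G).homEquiv _ _).injective
  refine pushout.hom_ext ?_ (colimit.hom_ext fun f => ?_)
  · rw [← Adjunction.homEquiv_naturality_left, h₁, Adjunction.homEquiv_naturality_left]
  · rw [← Category.assoc, ← Adjunction.homEquiv_naturality_left, h₂,
      Adjunction.homEquiv_naturality_left, Category.assoc]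

theorem exists_latching_desc (a : G.obj (X.obj c) ⟶ E)
    (b : ∀ f : LatchingCategory P c, G.obj (Y.obj f.left) ⟶ E)
    (hb : ∀ {f g : LatchingCategory P c} (h : f ⟶ g), G.map (Y.map h.1) ≫ b g = b f)
    (hab : ∀ f : LatchingCategory P c,
      G.map (X.map f.hom) ≫ a = G.map (φ.app f.left) ≫ b f) :
    ∃ l : G.obj (pushout (latchingMap P c X) (latchingObjHom P c φ)) ⟶ E,
      G.map (pushout.inl _ _) ≫ l = a ∧
      ∀ f : LatchingCategory P c,
        G.map (colimit.ι (latchingForget P c ⋙ Y) f ≫ pushout.inr _ _) ≫ l = b f := by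
  let e {Z : M} := (Adjunction.ofIsLeftAdjoint G).homEquiv Z E
  let β : latchingObj P c Y ⟶ G.rightAdjoint.obj E := colimit.desc (latchingForget P c ⋙ Y)
    { pt := G.rightAdjoint.obj E
      ι :=
        { app := fun f => e (b f)
          naturality := fun f g h => by
            change Y.map h.1 ≫ _ = _ ≫ 𝟙 _
            rw [Category.comp_id]
            exact (Adjunction.homEquiv_naturality_left _ _ _).symm.trans (congrArg e (hb h)) } }
  have hβ (f : LatchingCategory P c) :
      colimit.ι (latchingForget P c ⋙ Y) f ≫ β = e (b f) := colimit.ι_desc _ _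
  refine ⟨e.symm (pushout.desc (e a) β (colimit.hom_ext fun f => ?_)), ?_, fun f => ?_⟩
  · rw [reassoc_of% ι_latchingMap P c X f, reassoc_of% ι_latchingObjHom P c φ f, hβ]
    simp only [e]
    rw [← Adjunction.homEquiv_naturality_left, hab, Adjunction.homEquiv_naturality_left]
  · simp only [e]
    rw [← Adjunction.homEquiv_naturality_left_symm, pushout.inl_desc, Equiv.symm_apply_apply]
  · simp only [e]
    rw [← Adjunction.homEquiv_naturality_left_symm, Category.assoc, pushout.inr_desc, hβ]
    exact e.symm_apply_apply _

end LatchingDesc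

/-! ### Lifting against an exterior pushout-product at `(c₁, c₂)` -/

section PushoutProduct

variable {C₁ C₂ : Type v} [SmallCategory C₁] [SmallCategory C₂]
  {P₁ : MorphismProperty C₁} [P₁.IsMultiplicative] {P₂ : MorphismProperty C₂} [P₂.IsMultiplicative]
  {c₁ : C₁} {c₂ : C₂}

theorem identities_fst {X Y : C₁ × C₂} {f : X ⟶ Y}
    (h : MorphismProperty.identities (C₁ × C₂) f) : MorphismProperty.identities C₁ f.1 := by
  cases h
  constructor

theorem identities_snd {X Y : C₁ × C₂} {f : X ⟶ Y}
    (h : MorphismProperty.identities (C₁ × C₂) f) : MorphismProperty.identities C₂ f.2 := by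
  cases h
  constructor

/-- The object `(f, 𝟙)` of the latching category of a product. -/
abbrev LatchingCategory.left' (c₂ : C₂) (f : LatchingCategory P₁ c₁) :
    LatchingCategory (P₁.prod P₂) (c₁, c₂) where
  left := (f.left, c₂)
  hom := (f.hom, 𝟙 c₂)
  prop := ⟨f.prop, P₂.id_mem _⟩
  not_identity h := f.not_identity (identities_fst h)

/-- The object `(𝟙, g)` of the latching category of a product. -/
abbrev LatchingCategory.right' (c₁ : C₁) (g : LatchingCategory P₂ c₂) :
    LatchingCategory (P₁.prod P₂) (c₁, c₂) where
  left := (c₁, g.left)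
  hom := (𝟙 c₁, g.hom)
  prop := ⟨P₁.id_mem _, g.prop⟩
  not_identity h := g.not_identity (identities_snd h)

variable {M : Type u} [Category.{v} M] [HasColimits M] [MonoidalCategory M] [SymmetricCategory M]
  [MonoidalClosed M]

instance (T : M) : (tensorRight T).IsLeftAdjoint :=
  Functor.isLeftAdjoint_of_iso (BraidedCategory.tensorLeftIsoTensorRight T)

/-- Solution of the lifting problem of the relative latching map at `(c₁, c₂)` of an exterior
pushout-product against `p`, in terms of its components. -/
theorem exists_lift_of_pushoutProduct {X X' : C₁ ⥤ M} (i : X ⟶ X') {Y Y' : C₂ ⥤ M} (j : Y ⟶ Y')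
    {E B : M} (p : E ⟶ B)
    (sq : (curriedTensor M).PushoutObjObj
      (relativeLatchingMap P₁ c₁ i) (relativeLatchingMap P₂ c₂ j))
    (hp : HasLiftingProperty sq.ι p)
    (a₁ : X'.obj c₁ ⊗ Y.obj c₂ ⟶ E) (a₂ : X.obj c₁ ⊗ Y'.obj c₂ ⟶ E)
    (ξ : ∀ k : LatchingCategory (P₁.prod P₂) (c₁, c₂), X'.obj k.left.1 ⊗ Y'.obj k.left.2 ⟶ E)
    (b : X'.obj c₁ ⊗ Y'.obj c₂ ⟶ B)
    (h₀ : i.app c₁ ▷ Y.obj c₂ ≫ a₁ = X.obj c₁ ◁ j.app c₂ ≫ a₂)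
    (h₁ : ∀ k, (X'.map k.hom.1 ⊗ₘ Y.map k.hom.2) ≫ a₁ = X'.obj k.left.1 ◁ j.app k.left.2 ≫ ξ k)
    (h₂ : ∀ k, (X.map k.hom.1 ⊗ₘ Y'.map k.hom.2) ≫ a₂ = i.app k.left.1 ▷ Y'.obj k.left.2 ≫ ξ k)
    (hξ : ∀ {k k' : LatchingCategory (P₁.prod P₂) (c₁, c₂)} (h : k ⟶ k'),
      (X'.map h.1.1 ⊗ₘ Y'.map h.1.2) ≫ ξ k' = ξ k)
    (hp₁ : a₁ ≫ p = X'.obj c₁ ◁ j.app c₂ ≫ b)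
    (hp₂ : a₂ ≫ p = i.app c₁ ▷ Y'.obj c₂ ≫ b)
    (hpξ : ∀ k, ξ k ≫ p = (X'.map k.hom.1 ⊗ₘ Y'.map k.hom.2) ≫ b) :
    ∃ l : X'.obj c₁ ⊗ Y'.obj c₂ ⟶ E,
      X'.obj c₁ ◁ j.app c₂ ≫ l = a₁ ∧ i.app c₁ ▷ Y'.obj c₂ ≫ l = a₂ ∧
      (∀ k, (X'.map k.hom.1 ⊗ₘ Y'.map k.hom.2) ≫ l = ξ k) ∧ l ≫ p = b := by
  let fl (f : LatchingCategory P₁ c₁) : LatchingCategory (P₁.prod P₂) (c₁, c₂) := f.left' c₂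
  let fr (g : LatchingCategory P₂ c₂) : LatchingCategory (P₁.prod P₂) (c₁, c₂) := g.right' c₁
  have h₁l (f : LatchingCategory P₁ c₁) :
      X'.map f.hom ▷ Y.obj c₂ ≫ a₁ = X'.obj f.left ◁ j.app c₂ ≫ ξ (fl f) := by
    rw [← tensorHom_id, ← Y.map_id]
    exact h₁ (fl f)
  have h₁r (g : LatchingCategory P₂ c₂) :
      X'.obj c₁ ◁ Y.map g.hom ≫ a₁ = X'.obj c₁ ◁ j.app g.left ≫ ξ (fr g) := by
    rw [← id_tensorHom, ← X'.map_id]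
    exact h₁ (fr g)
  have h₂l (f : LatchingCategory P₁ c₁) :
      X.map f.hom ▷ Y'.obj c₂ ≫ a₂ = i.app f.left ▷ Y'.obj c₂ ≫ ξ (fl f) := by
    rw [← tensorHom_id, ← Y'.map_id]
    exact h₂ (fl f)
  have h₂r (g : LatchingCategory P₂ c₂) :
      X.obj c₁ ◁ Y'.map g.hom ≫ a₂ = i.app c₁ ▷ Y'.obj g.left ≫ ξ (fr g) := by
    rw [← id_tensorHom, ← X.map_id]
    exact h₂ (fr g)
  have hξl {f f' : LatchingCategory P₁ c₁} (h : f ⟶ f') :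
      X'.map h.1 ▷ Y'.obj c₂ ≫ ξ (fl f') = ξ (fl f) := by
    rw [← tensorHom_id, ← Y'.map_id]
    exact hξ (k := fl f) (k' := fl f') ⟨(h.1, 𝟙 _), ⟨h.2.1, P₂.id_mem _⟩,
      Prod.ext h.2.2 (Category.comp_id _)⟩
  have hξr {g g' : LatchingCategory P₂ c₂} (h : g ⟶ g') :
      X'.obj c₁ ◁ Y'.map h.1 ≫ ξ (fr g') = ξ (fr g) := by
    rw [← id_tensorHom, ← X'.map_id]
    exact hξ (k := fr g) (k' := fr g') ⟨(𝟙 _, h.1), ⟨P₁.id_mem _, h.2.1⟩,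
      Prod.ext (Category.comp_id _) h.2.2⟩
  -- The arrow `(𝟙, g)` goes from `k = (f, g)` to `(f, 𝟙)` in the latching category. With the
  -- symmetric fact below, `ξ` is determined by its values at the objects `(f, 𝟙)` and `(𝟙, g)`.
  have hξkl (k : LatchingCategory (P₁.prod P₂) (c₁, c₂))
      (hk : ¬ MorphismProperty.identities C₁ k.hom.1) :
      X'.obj k.left.1 ◁ Y'.map k.hom.2 ≫ ξ (fl ⟨_, _, k.prop.1, hk⟩) = ξ k := by
    rw [← id_tensorHom, ← X'.map_id]
    exact hξ (k := k) (k' := fl ⟨_, _, k.prop.1, hk⟩) ⟨(𝟙 _, k.hom.2), ⟨P₁.id_mem _, k.prop.2⟩,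
      Prod.ext (Category.id_comp _) (Category.comp_id _)⟩
  have hξkr (k : LatchingCategory (P₁.prod P₂) (c₁, c₂))
      (hk : ¬ MorphismProperty.identities C₂ k.hom.2) :
      X'.map k.hom.1 ▷ Y'.obj k.left.2 ≫ ξ (fr ⟨_, _, k.prop.2, hk⟩) = ξ k := by
    rw [← tensorHom_id, ← Y'.map_id]
    exact hξ (k := k) (k' := fr ⟨_, _, k.prop.2, hk⟩) ⟨(k.hom.1, 𝟙 _), ⟨k.prop.1, P₂.id_mem _⟩,
      Prod.ext (Category.comp_id _) (Category.id_comp _)⟩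
  -- `s` and `t` are the two legs of a map out of the domain of `sq.ι`: `s` glues `a₁` with the `ξ
  -- (𝟙, g)`, and `t` glues `a₂` with the `ξ (f, 𝟙)`.
  obtain ⟨s, hs₁, hs₂⟩ :
      ∃ s : X'.obj c₁ ⊗ pushout (latchingMap P₂ c₂ Y) (latchingObjHom P₂ c₂ j) ⟶ E,
      X'.obj c₁ ◁ pushout.inl _ _ ≫ s = a₁ ∧ ∀ g : LatchingCategory P₂ c₂,
        X'.obj c₁ ◁ (colimit.ι (latchingForget P₂ c₂ ⋙ Y') g ≫ pushout.inr _ _) ≫ s = ξ (fr g) :=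
    exists_latching_desc P₂ (c := c₂) j (tensorLeft (X'.obj c₁)) a₁ (fun g => ξ (fr g)) hξr h₁r
  obtain ⟨t, ht₁, ht₂⟩ :
      ∃ t : pushout (latchingMap P₁ c₁ X) (latchingObjHom P₁ c₁ i) ⊗ Y'.obj c₂ ⟶ E,
      pushout.inl _ _ ▷ Y'.obj c₂ ≫ t = a₂ ∧ ∀ f : LatchingCategory P₁ c₁,
        (colimit.ι (latchingForget P₁ c₁ ⋙ X') f ≫ pushout.inr _ _) ▷ Y'.obj c₂ ≫ t = ξ (fl f) :=
    exists_latching_desc P₁ (c := c₁) i (tensorRight (Y'.obj c₂)) a₂ (fun f => ξ (fl f)) hξl h₂l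
  have ri₁ : pushout.inl _ _ ≫ relativeLatchingMap P₁ c₁ i = i.app c₁ := pushout.inl_desc _ _ _
  have rj₁ : pushout.inl _ _ ≫ relativeLatchingMap P₂ c₂ j = j.app c₂ := pushout.inl_desc _ _ _
  have ri₂ (f : LatchingCategory P₁ c₁) : (colimit.ι (latchingForget P₁ c₁ ⋙ X') f ≫
      pushout.inr _ _) ≫ relativeLatchingMap P₁ c₁ i = X'.map f.hom := by
    rw [Category.assoc, relativeLatchingMap, pushout.inr_desc, ι_latchingMap]
  have rj₂ (g : LatchingCategory P₂ c₂) : (colimit.ι (latchingForget P₂ c₂ ⋙ Y') g ≫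
      pushout.inr _ _) ≫ relativeLatchingMap P₂ c₂ j = Y'.map g.hom := by
    rw [Category.assoc, relativeLatchingMap, pushout.inr_desc, ι_latchingMap]
  -- Agreement is checked on the four pieces of a tensor product of two pushouts. On the
  -- latching-latching piece both sides equal `ξ (f, g)`.
  have hst : relativeLatchingMap P₁ c₁ i ▷ _ ≫ s = _ ◁ relativeLatchingMap P₂ c₂ j ≫ t := by
    refine latching_hom_ext (tensorRight _) ?_ (fun f => ?_)
    · change pushout.inl _ _ ▷ _ ≫ _ = pushout.inl _ _ ▷ _ ≫ _
      rw [← comp_whiskerRight_assoc, ri₁, ← whisker_exchange_assoc, ht₁]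
      refine latching_hom_ext (tensorLeft _) ?_ (fun g => ?_)
      · change _ ◁ pushout.inl _ _ ≫ _ = _ ◁ pushout.inl _ _ ≫ _
        rw [whisker_exchange_assoc, hs₁, ← whiskerLeft_comp_assoc, rj₁, h₀]
      · change _ ◁ (_ ≫ pushout.inr _ _) ≫ _ = _ ◁ (_ ≫ pushout.inr _ _) ≫ _
        rw [whisker_exchange_assoc, hs₂, ← whiskerLeft_comp_assoc, rj₂]
        exact (h₂r g).symm
    · change (_ ≫ pushout.inr _ _) ▷ _ ≫ _ = (_ ≫ pushout.inr _ _) ▷ _ ≫ _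
      rw [← comp_whiskerRight_assoc, ri₂, ← whisker_exchange_assoc, ht₂]
      refine latching_hom_ext (tensorLeft _) ?_ (fun g => ?_)
      · change _ ◁ pushout.inl _ _ ≫ _ = _ ◁ pushout.inl _ _ ≫ _
        rw [whisker_exchange_assoc, hs₁, ← whiskerLeft_comp_assoc, rj₁]
        exact h₁l f
      · change _ ◁ (_ ≫ pushout.inr _ _) ≫ _ = _ ◁ (_ ≫ pushout.inr _ _) ≫ _
        rw [whisker_exchange_assoc, hs₂, ← whiskerLeft_comp_assoc, rj₂]
        let k : LatchingCategory (P₁.prod P₂) (c₁, c₂) :=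
          ⟨(f.left, g.left), (f.hom, g.hom), ⟨f.prop, g.prop⟩,
            fun h => f.not_identity (identities_fst h)⟩
        exact (hξkr k g.not_identity).trans (hξkl k f.not_identity).symm
  have sq' : CommSq (sq.isPushout.desc s t hst) sq.ι p b := ⟨by
    refine sq.hom_ext ?_ ?_
    · rw [sq.isPushout.inl_desc_assoc, sq.inl_ι_assoc]
      refine latching_hom_ext (tensorLeft _) ?_ (fun g => ?_)
      · change _ ◁ pushout.inl _ _ ≫ _ = _ ◁ pushout.inl _ _ ≫ _ ◁ _ ≫ _
        rw [reassoc_of% hs₁, ← whiskerLeft_comp_assoc, rj₁, hp₁]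
      · change _ ◁ (_ ≫ pushout.inr _ _) ≫ _ = _ ◁ (_ ≫ pushout.inr _ _) ≫ _ ◁ _ ≫ _
        rw [reassoc_of% hs₂, ← whiskerLeft_comp_assoc, rj₂, hpξ, X'.map_id, id_tensorHom]
    · rw [sq.isPushout.inr_desc_assoc, sq.inr_ι_assoc]
      refine latching_hom_ext (tensorRight _) ?_ (fun f => ?_)
      · change pushout.inl _ _ ▷ _ ≫ _ = pushout.inl _ _ ▷ _ ≫ _ ▷ _ ≫ _
        rw [reassoc_of% ht₁, ← comp_whiskerRight_assoc, ri₁, hp₂]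
      · change (_ ≫ pushout.inr _ _) ▷ _ ≫ _ = (_ ≫ pushout.inr _ _) ▷ _ ≫ _ ▷ _ ≫ _
        rw [reassoc_of% ht₂, ← comp_whiskerRight_assoc, ri₂, hpξ, Y'.map_id, tensorHom_id]⟩
  obtain ⟨l, hl, hl'⟩ : ∃ l, sq.ι ≫ l = sq.isPushout.desc s t hst ∧ l ≫ p = b :=
    ⟨sq'.lift, sq'.fac_left, sq'.fac_right⟩
  have hs : X'.obj c₁ ◁ relativeLatchingMap P₂ c₂ j ≫ l = s := by
    have := sq.inl ≫= hl
    rwa [sq.isPushout.inl_desc, sq.inl_ι_assoc] at this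
  have ht : relativeLatchingMap P₁ c₁ i ▷ Y'.obj c₂ ≫ l = t := by
    have := sq.inr ≫= hl
    rwa [sq.isPushout.inr_desc, sq.inr_ι_assoc] at this
  have hl₁ (f : LatchingCategory P₁ c₁) : X'.map f.hom ▷ Y'.obj c₂ ≫ l = ξ (fl f) := by
    rw [← ht₂, ← ht, ← comp_whiskerRight_assoc, ri₂]
  have hl₂ (g : LatchingCategory P₂ c₂) : X'.obj c₁ ◁ Y'.map g.hom ≫ l = ξ (fr g) := by
    rw [← hs₂, ← hs, ← whiskerLeft_comp_assoc, rj₂]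
  refine ⟨l, ?_, ?_, fun k => ?_, hl'⟩
  · rw [← rj₁, whiskerLeft_comp_assoc, hs, hs₁]
  · rw [← ri₁, comp_whiskerRight_assoc, ht, ht₁]
  -- At least one component of `k` is not an identity, so `ξ k` is recovered from `ξ (𝟙, g)` or `ξ
  -- (f, 𝟙)`.
  · by_cases hk : MorphismProperty.identities C₁ k.hom.1
    · have hk' : ¬ MorphismProperty.identities C₂ k.hom.2 :=
        fun h => k.not_identity (ReedyStructure.prod_identities _ hk h)
      rw [← hξkr k hk', MonoidalCategory.tensorHom_def, ← hl₂, Category.assoc]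
    · rw [← hξkl k hk, MonoidalCategory.tensorHom_def', ← hl₁, Category.assoc]

end PushoutProduct
-- Independence of the chosen pushout, and lifting for relative latching maps
section PushoutObjObj

variable {C₁ : Type u₁} [Category.{v₁} C₁] {C₂ : Type u₂} [Category.{v₂} C₂]
  {C₃ : Type u₃} [Category.{v₃} C₃] {F : C₁ ⥤ C₂ ⥤ C₃}
  {X₁ Y₁ : C₁} {f₁ : X₁ ⟶ Y₁} {X₂ Y₂ : C₂} {f₂ : X₂ ⟶ Y₂}

theorem pushoutObjObj_ι_mem_iff (W : MorphismProperty C₃) [W.RespectsIso]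
    (sq sq' : F.PushoutObjObj f₁ f₂) : W sq.ι ↔ W sq'.ι := by
  refine W.arrow_mk_iso_iff (Arrow.isoMk (sq.isPushout.isoIsPushout _ _ sq'.isPushout)
    (Iso.refl _) ?_)
  refine sq.hom_ext ?_ ?_ <;> simp

end PushoutObjObj

section Latching

variable {C : Type v} [SmallCategory C] {P : MorphismProperty C} [P.IsMultiplicative] {c : C}
  {M : Type u} [Category.{v} M] [HasColimits M]

/-- A lifting property of a relative latching map, in terms of its components. -/
theorem hasLiftingProperty_relativeLatchingMap {Z T : C ⥤ M} {ψ : Z ⟶ T} {E B : M} {p : E ⟶ B}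
    (H : ∀ (a : Z.obj c ⟶ E) (ξ : ∀ k : LatchingCategory P c, T.obj k.left ⟶ E) (b : T.obj c ⟶ B),
      (∀ k, Z.map k.hom ≫ a = ψ.app k.left ≫ ξ k) →
      (∀ {k k' : LatchingCategory P c} (h : k ⟶ k'), T.map h.1 ≫ ξ k' = ξ k) →
      a ≫ p = ψ.app c ≫ b → (∀ k, ξ k ≫ p = T.map k.hom ≫ b) →
      ∃ l : T.obj c ⟶ E, ψ.app c ≫ l = a ∧ (∀ k : LatchingCategory P c, T.map k.hom ≫ l = ξ k) ∧
        l ≫ p = b) :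
    HasLiftingProperty (relativeLatchingMap P c ψ) p := by
  refine ⟨fun {u b} S => ?_⟩
  obtain ⟨l, hl, hlξ, hlp⟩ := H (pushout.inl _ _ ≫ u)
    (fun k => colimit.ι (latchingForget P c ⋙ T) k ≫ pushout.inr _ _ ≫ u) b
    (fun k => by
      rw [← reassoc_of% (ι_latchingObjHom P c ψ k), ← pushout.condition_assoc,
        reassoc_of% (ι_latchingMap P c Z k)])
    (fun h => colimit.w_assoc (latchingForget P c ⋙ T) h _)
    (by
      have := pushout.inl _ _ ≫= S.w
      rwa [relativeLatchingMap, pushout.inl_desc_assoc, ← Category.assoc] at this)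
    (fun k => by
      have := colimit.ι _ k ≫= (pushout.inr _ _ ≫= S.w)
      rw [relativeLatchingMap, pushout.inr_desc_assoc, reassoc_of% (ι_latchingMap P c T k)] at this
      simpa only [Category.assoc] using this)
  refine ⟨⟨l, pushout.hom_ext ?_ (colimit.hom_ext fun k => ?_), hlp⟩⟩
  · rw [relativeLatchingMap, pushout.inl_desc_assoc, hl]
  · rw [relativeLatchingMap, pushout.inr_desc_assoc, reassoc_of% (ι_latchingMap P c T k), hlξ]

end Latching

/-! ### The pushout-product axiom for the exterior tensor product -/

section Exterior

variable {A : Type v} [SmallCategory A] {M : Type u} [Category.{v} M] [MonoidalCategory M]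

theorem exteriorTensor_obj_obj_map (X Y : Aᵒᵖ ⥤ M) {a a' : Aᵒᵖ × Aᵒᵖ} (f : a ⟶ a') :
    (((exteriorTensor A M).obj X).obj Y).map f = X.map f.1 ⊗ₘ Y.map f.2 :=
  (MonoidalCategory.tensorHom_def _ _).symm

variable [HasColimits M]

/-- The components of an exterior pushout-product are pushout-products. -/
abbrev exteriorPushoutApp {X X' : Aᵒᵖ ⥤ M} {i : X ⟶ X'} {Y Y' : Aᵒᵖ ⥤ M} {j : Y ⟶ Y'}
    (sq : (exteriorTensor A M).PushoutObjObj i j) (a : Aᵒᵖ × Aᵒᵖ) :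
    (curriedTensor M).PushoutObjObj (i.app a.1) (j.app a.2) where
  pt := sq.pt.obj a
  inl := sq.inl.app a
  inr := sq.inr.app a
  isPushout := sq.isPushout.map ((evaluation _ _).obj a)
  ι := sq.ι.app a
  inl_ι := NatTrans.congr_app sq.inl_ι a
  inr_ι := NatTrans.congr_app sq.inr_ι a

variable [SymmetricCategory M] [MonoidalClosed M]

/-- Pushouts of diagrams are objectwise, so a map out of the pushout at `c` is a compatible pair of
maps out of `X'_{c₁} ⊗ Y_{c₂}` and `X_{c₁} ⊗ Y'_{c₂}`. This puts the problem in the form of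
`exists_lift_of_pushoutProduct`. -/
theorem hasLiftingProperty_relativeLatchingMap_pushoutProduct
    {P₁ P₂ : MorphismProperty Aᵒᵖ} [P₁.IsMultiplicative] [P₂.IsMultiplicative]
    {X X' : Aᵒᵖ ⥤ M} {i : X ⟶ X'} {Y Y' : Aᵒᵖ ⥤ M} {j : Y ⟶ Y'}
    (sq : (exteriorTensor A M).PushoutObjObj i j) (c : Aᵒᵖ × Aᵒᵖ) {E B : M} (p : E ⟶ B)
    (sqM : (curriedTensor M).PushoutObjObj
      (relativeLatchingMap P₁ c.1 i) (relativeLatchingMap P₂ c.2 j))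
    (hp : HasLiftingProperty sqM.ι p) :
    HasLiftingProperty (relativeLatchingMap (P₁.prod P₂) c sq.ι) p := by
  obtain ⟨c₁, c₂⟩ := c
  refine hasLiftingProperty_relativeLatchingMap fun a ξ b h hξ hp' hpξ => ?_
  let sqc := exteriorPushoutApp sq (c₁, c₂)
  obtain ⟨l, hl₁, hl₂, hlξ, hlp⟩ := exists_lift_of_pushoutProduct (P₁ := P₁) (P₂ := P₂) (c₁ := c₁)
    (c₂ := c₂) i j p sqM hp (sqc.inl ≫ a) (sqc.inr ≫ a) ξ b
    (sqc.isPushout.w_assoc a)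
    (fun k => by
      have h₁ := sq.inl.naturality_assoc k.hom a
      rw [h, ← NatTrans.comp_app_assoc, sq.inl_ι, exteriorTensor_obj_obj_map] at h₁
      exact h₁)
    (fun k => by
      have h₁ := sq.inr.naturality_assoc k.hom a
      rw [h, ← NatTrans.comp_app_assoc, sq.inr_ι, exteriorTensor_obj_obj_map] at h₁
      exact h₁)
    (fun k => by
      have := hξ k
      rw [exteriorTensor_obj_obj_map] at this
      exact this)
    (by rw [Category.assoc, hp']; exact sqc.inl_ι_assoc b)
    (by rw [Category.assoc, hp']; exact sqc.inr_ι_assoc b)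
    (fun k => by
      have := hpξ k
      rw [exteriorTensor_obj_obj_map] at this
      exact this)
  refine ⟨l, sqc.hom_ext ?_ ?_, fun k => ?_, hlp⟩
  · exact (sqc.inl_ι_assoc l).trans hl₁
  · exact (sqc.inr_ι_assoc l).trans hl₂
  · rw [exteriorTensor_obj_obj_map]
    exact hlξ k

theorem exteriorTensor_pushoutProductAxiom [HasLimits M] [ModelCategory M]
    (hM : PushoutProductAxiom (ModelClasses.ofModelCategory M)
      (ModelClasses.ofModelCategory M) (ModelClasses.ofModelCategory M) (curriedTensor M))
    {W₁ W₂ W₁' W₂' : MorphismProperty Aᵒᵖ} [W₁.IsMultiplicative] [W₂.IsMultiplicative]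
    [W₁'.IsMultiplicative] [W₂'.IsMultiplicative]
    {α : Type w} [LinearOrder α] [OrderBot α] [SuccOrder α] [WellFoundedLT α]
    {β : Type w} [LinearOrder β] [OrderBot β] [SuccOrder β] [WellFoundedLT β]
    (r : ReedyStructure W₁ W₂ α) (r' : ReedyStructure W₁' W₂' β) :
    PushoutProductAxiom (reedyModelClasses r M) (reedyModelClasses r' M)
      (reedyModelClasses (r.prod r') M) (exteriorTensor A M) where
  cofibration i _ _ j hi hj c := by
    rw [cofibration_iff, ← trivialFibrations_llp]
    intro E B p hp
    obtain ⟨_, _⟩ := (mem_trivialFibrations_iff p).1 hp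
    refine hasLiftingProperty_relativeLatchingMap_pushoutProduct _ c p
      (Functor.PushoutObjObj.ofHasPushout _ _ _) ?_
    have : Cofibration (Functor.PushoutObjObj.ofHasPushout (curriedTensor M)
        (relativeLatchingMap W₂ c.1 i) (relativeLatchingMap W₂' c.2 j)).ι :=
      ⟨hM.cofibration _ _ ((cofibration_iff _).1 (hi c.1)) ((cofibration_iff _).1 (hj c.2))⟩
    infer_instance
  weakEquivalence i _ _ j hi hj h c := by
    have hi' := cofibration_app_of_relativeLatchingMap r.lt₂ i hi
    have hj' := cofibration_app_of_relativeLatchingMap r'.lt₂ j hj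
    rw [weakEquivalence_iff]
    refine (pushoutObjObj_ι_mem_iff _ (exteriorPushoutApp _ c)
      (Functor.PushoutObjObj.ofHasPushout _ _ _)).2
      (hM.weakEquivalence _ _ (hi' c.1).mem (hj' c.2).mem ?_)
    exact h.imp (fun h => (h c.1).mem) (fun h => (h c.2).mem)

end Exterior

/-! ### Weighted Hom and the adjunction attached to a coend presentation -/

section WeightedHom

variable {A : Type v} [SmallCategory A] {J : Type v} [SmallCategory J]
  {M : Type u} [Category.{v} M] [MonoidalCategory M] [MonoidalClosed M] [HasLimits M]
  {C : Type u₁} [Category.{v₁} C] (K : C ⥤ A ⥤ (J ⥤ M))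

/-- The bifunctor `(Y, F) ↦ (α ↦ MOR(K(Y, α), F))`. -/
noncomputable def weightedHom : Cᵒᵖ ⥤ (J ⥤ M) ⥤ (Aᵒᵖ ⥤ M) :=
  K.op ⋙ Functor.opHom _ _ ⋙
    (Functor.whiskeringRight _ _ _).obj (enrichedHomFunctor J M) ⋙ flipFunctor _ _ _

variable {K}

/-- The projections of `MOR(K(Y, α), F)`. -/
noncomputable def weightedHomπ (Y : C) (F : J ⥤ M) (a : A) (j : J) :
    (((weightedHom K).obj (op Y)).obj F).obj (op a) ⟶
      (ihom (((K.obj Y).obj a).obj j)).obj (F.obj j) :=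
  end_.π (((internalHomDiagram J M).obj (op ((K.obj Y).obj a))).obj F) j

theorem weightedHom_hom_ext {Y : C} {F : J ⥤ M} {a : A} {T : M}
    {f g : T ⟶ (((weightedHom K).obj (op Y)).obj F).obj (op a)}
    (h : ∀ j, f ≫ weightedHomπ Y F a j = g ≫ weightedHomπ Y F a j) : f = g :=
  end_.hom_ext (F := ((internalHomDiagram J M).obj (op ((K.obj Y).obj a))).obj F) h

theorem weightedHomπ_condition (Y : C) (F : J ⥤ M) (a : A) {j j' : J} (f : j ⟶ j') :
    weightedHomπ Y F a j ≫ (ihom (((K.obj Y).obj a).obj j)).map (F.map f) =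
      weightedHomπ Y F a j' ≫ (MonoidalClosed.pre (((K.obj Y).obj a).map f)).app (F.obj j') :=
  end_.condition (((internalHomDiagram J M).obj (op ((K.obj Y).obj a))).obj F) f

/-- The universal property of `MOR(K(Y, α), F)`. -/
noncomputable def weightedHomLift {Y : C} {F : J ⥤ M} {a : A} {T : M}
    (f : ∀ j, ((K.obj Y).obj a).obj j ⊗ T ⟶ F.obj j)
    (hf : ∀ ⦃j j' : J⦄ (g : j ⟶ j'),
      f j ≫ F.map g = ((K.obj Y).obj a).map g ▷ T ≫ f j') :
    T ⟶ (((weightedHom K).obj (op Y)).obj F).obj (op a) :=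
  end_.lift (F := ((internalHomDiagram J M).obj (op ((K.obj Y).obj a))).obj F)
    (fun j => MonoidalClosed.curry (f j)) (fun j j' g => by
      change MonoidalClosed.curry (f j) ≫ (ihom (((K.obj Y).obj a).obj j)).map (F.map g) =
        MonoidalClosed.curry (f j') ≫
          (MonoidalClosed.pre (((K.obj Y).obj a).map g)).app (F.obj j')
      rw [← MonoidalClosed.curry_natural_right, MonoidalClosed.curry_pre_app, hf])

theorem weightedHomLift_π {Y : C} {F : J ⥤ M} {a : A} {T : M}
    (f : ∀ j, ((K.obj Y).obj a).obj j ⊗ T ⟶ F.obj j)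
    (hf : ∀ ⦃j j' : J⦄ (g : j ⟶ j'),
      f j ≫ F.map g = ((K.obj Y).obj a).map g ▷ T ≫ f j') (j : J) :
    weightedHomLift f hf ≫ weightedHomπ Y F a j = MonoidalClosed.curry (f j) :=
  end_.lift_π _ _ j

theorem weightedHom_map_π (Y : C) (F : J ⥤ M) {a b : A} (f : a ⟶ b) (j : J) :
    (((weightedHom K).obj (op Y)).obj F).map f.op ≫ weightedHomπ Y F a j =
      weightedHomπ Y F b j ≫ (MonoidalClosed.pre (((K.obj Y).map f).app j)).app (F.obj j) :=
  end_.map_π _ j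

theorem weightedHom_map_app_π (Y : C) {F F' : J ⥤ M} (φ : F ⟶ F') (a : A) (j : J) :
    (((weightedHom K).obj (op Y)).map φ).app (op a) ≫ weightedHomπ Y F' a j =
      weightedHomπ Y F a j ≫ (ihom (((K.obj Y).obj a).obj j)).map (φ.app j) :=
  end_.map_π _ j

theorem weightedHom_map_app_app_π {Y Y' : C} (f : Y ⟶ Y') (F : J ⥤ M) (a : A) (j : J) :
    (((weightedHom K).map f.op).app F).app (op a) ≫ weightedHomπ Y F a j =
      weightedHomπ Y' F a j ≫ (MonoidalClosed.pre (((K.map f).app a).app j)).app (F.obj j) :=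
  end_.map_π _ j

variable (K)

/-- The datum which expresses that `Φ(Y, X)` is the coend `∫^α K(Y, α) ⊗ X_α`, functorially in
`X` and `Y`. -/
structure CoendPresentation (Φ : C ⥤ (Aᵒᵖ ⥤ M) ⥤ (J ⥤ M)) where
  /-- the inclusions in the coend -/
  κ (Y : C) (X : Aᵒᵖ ⥤ M) (a : A) (j : J) :
    ((K.obj Y).obj a).obj j ⊗ X.obj (op a) ⟶ ((Φ.obj Y).obj X).obj j
  κ_map (Y : C) (X : Aᵒᵖ ⥤ M) (a : A) {j j' : J} (f : j ⟶ j') :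
    ((K.obj Y).obj a).map f ▷ X.obj (op a) ≫ κ Y X a j' = κ Y X a j ≫ ((Φ.obj Y).obj X).map f
  κ_naturality₁ {Y Y' : C} (f : Y ⟶ Y') (X : Aᵒᵖ ⥤ M) (a : A) (j : J) :
    ((K.map f).app a).app j ▷ X.obj (op a) ≫ κ Y' X a j = κ Y X a j ≫ ((Φ.map f).app X).app j
  κ_naturality₂ (Y : C) {X X' : Aᵒᵖ ⥤ M} (g : X ⟶ X') (a : A) (j : J) :
    ((K.obj Y).obj a).obj j ◁ g.app (op a) ≫ κ Y X' a j = κ Y X a j ≫ ((Φ.obj Y).map g).app j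
  κ_condition (Y : C) (X : Aᵒᵖ ⥤ M) {a b : A} (f : a ⟶ b) (j : J) :
    ((K.obj Y).map f).app j ▷ X.obj (op b) ≫ κ Y X b j =
      ((K.obj Y).obj a).obj j ◁ X.map f.op ≫ κ Y X a j
  -- The universal property is required at each `j` separately; naturality in `j` of induced maps
  -- then follows from uniqueness and `κ_map`.
  existsUnique_desc (Y : C) (X : Aᵒᵖ ⥤ M) (j : J) {Z : M}
    (θ : ∀ a, ((K.obj Y).obj a).obj j ⊗ X.obj (op a) ⟶ Z)
    (hθ : ∀ {a b : A} (f : a ⟶ b), ((K.obj Y).map f).app j ▷ X.obj (op b) ≫ θ b =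
      ((K.obj Y).obj a).obj j ◁ X.map f.op ≫ θ a) :
    ∃! l : ((Φ.obj Y).obj X).obj j ⟶ Z, ∀ a, κ Y X a j ≫ l = θ a

namespace CoendPresentation

variable {K} {Φ : C ⥤ (Aᵒᵖ ⥤ M) ⥤ (J ⥤ M)} (p : CoendPresentation K Φ)

omit [MonoidalClosed M] [HasLimits M] in
include p in
theorem hom_ext {Y : C} {X : Aᵒᵖ ⥤ M} {j : J} {Z : M} {l l' : ((Φ.obj Y).obj X).obj j ⟶ Z}
    (h : ∀ a, p.κ Y X a j ≫ l = p.κ Y X a j ≫ l') : l = l' :=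
  (p.existsUnique_desc Y X j (fun a => p.κ Y X a j ≫ l')
    (fun f => by rw [reassoc_of% p.κ_condition])).unique h (fun _ => rfl)

/-- The morphism `X ⟶ MOR(K(Y, -), F)` which corresponds to `g : Φ(Y, X) ⟶ F`. -/
noncomputable def toHom {Y : C} {X : Aᵒᵖ ⥤ M} {F : J ⥤ M} (g : (Φ.obj Y).obj X ⟶ F) :
    X ⟶ ((weightedHom K).obj (op Y)).obj F where
  app a := weightedHomLift (a := a.unop) (fun j => p.κ Y X a.unop j ≫ g.app j)
    (fun j j' f => by rw [reassoc_of% p.κ_map, Category.assoc, g.naturality])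
  -- Naturality in `α` is the coend relation `κ_condition`, transposed.
  naturality b a f := by
    refine weightedHom_hom_ext (a := a.unop) fun j => ?_
    have h := weightedHom_map_π (K := K) Y F f.unop j
    have hκ := p.κ_condition Y X f.unop j
    change (_ ≫ weightedHomLift _ _) ≫ _ = (weightedHomLift _ _ ≫
      (((weightedHom K).obj (op Y)).obj F).map f.unop.op) ≫ _
    rw [Category.assoc, weightedHomLift_π, Category.assoc, h, reassoc_of% weightedHomLift_π,
      MonoidalClosed.curry_pre_app, ← MonoidalClosed.curry_natural_left, reassoc_of% hκ]
    rfl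

theorem toHom_app_π {Y : C} {X : Aᵒᵖ ⥤ M} {F : J ⥤ M} (g : (Φ.obj Y).obj X ⟶ F) (a : A) (j : J) :
    (p.toHom g).app (op a) ≫ weightedHomπ Y F a j = MonoidalClosed.curry (p.κ Y X a j ≫ g.app j) :=
  weightedHomLift_π (fun j => p.κ Y X a j ≫ g.app j)
    (fun j j' f => by rw [reassoc_of% p.κ_map, Category.assoc, g.naturality]) j

/-- Naturality of `t` is exactly the coend relation for the uncurried components. -/
theorem existsUnique_desc_of_hom {Y : C} {X : Aᵒᵖ ⥤ M} {F : J ⥤ M}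
    (t : X ⟶ ((weightedHom K).obj (op Y)).obj F) (j : J) :
    ∃! l : ((Φ.obj Y).obj X).obj j ⟶ F.obj j, ∀ a, p.κ Y X a j ≫ l =
      MonoidalClosed.uncurry (t.app (op a) ≫ weightedHomπ Y F a j) :=
  p.existsUnique_desc Y X j _ (fun {a b} f => by
    rw [← MonoidalClosed.uncurry_natural_left, ← MonoidalClosed.uncurry_pre_app, Category.assoc,
      ← weightedHom_map_π, reassoc_of% t.naturality f.op])

/-- The morphism `Φ(Y, X) ⟶ F` which corresponds to `t : X ⟶ MOR(K(Y, -), F)`. -/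
noncomputable def ofHom {Y : C} {X : Aᵒᵖ ⥤ M} {F : J ⥤ M}
    (t : X ⟶ ((weightedHom K).obj (op Y)).obj F) :
    (Φ.obj Y).obj X ⟶ F where
  app j := (p.existsUnique_desc_of_hom t j).choose
  naturality j j' f := p.hom_ext fun a => by
    have h (j : J) := (p.existsUnique_desc_of_hom t j).choose_spec.1 a
    dsimp only at h
    rw [← reassoc_of% p.κ_map, h, reassoc_of% h, ← MonoidalClosed.uncurry_natural_right,
      Category.assoc, weightedHomπ_condition, ← Category.assoc, MonoidalClosed.uncurry_pre_app]

theorem κ_ofHom_app {Y : C} {X : Aᵒᵖ ⥤ M} {F : J ⥤ M}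
    (t : X ⟶ ((weightedHom K).obj (op Y)).obj F) (a : A) (j : J) :
    p.κ Y X a j ≫ (p.ofHom t).app j =
      MonoidalClosed.uncurry (t.app (op a) ≫ weightedHomπ Y F a j) :=
  (p.existsUnique_desc_of_hom t j).choose_spec.1 a

/-- The bijection `Hom(Φ(Y, X), F) ≃ Hom(X, MOR(K(Y, -), F))`. -/
noncomputable def homEquiv (Y : C) (X : Aᵒᵖ ⥤ M) (F : J ⥤ M) :
    ((Φ.obj Y).obj X ⟶ F) ≃ (X ⟶ ((weightedHom K).obj (op Y)).obj F) where
  toFun g := p.toHom g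
  invFun t := p.ofHom t
  left_inv g := by
    ext j
    exact p.hom_ext fun a => by rw [κ_ofHom_app, toHom_app_π, MonoidalClosed.uncurry_curry]
  right_inv t := by
    ext ⟨a⟩
    exact weightedHom_hom_ext fun j => by
      rw [toHom_app_π, κ_ofHom_app, MonoidalClosed.curry_uncurry]

/-- The adjunction `Φ(Y, -) ⊣ MOR(K(Y, -), -)`. -/
noncomputable def adjunction (Y : C) : Φ.obj Y ⊣ (weightedHom K).obj (op Y) :=
  Adjunction.mkOfHomEquiv
    { homEquiv := p.homEquiv Y
      homEquiv_naturality_left_symm := fun {X X'} F g t => by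
        change p.ofHom _ = _ ≫ p.ofHom _
        ext j
        exact p.hom_ext fun a => by
          rw [κ_ofHom_app, NatTrans.comp_app, NatTrans.comp_app, Category.assoc,
            ← reassoc_of% p.κ_naturality₂, κ_ofHom_app, MonoidalClosed.uncurry_natural_left]
      homEquiv_naturality_right := fun {X F F'} g φ => by
        change p.toHom _ = p.toHom _ ≫ _
        ext ⟨a⟩
        exact weightedHom_hom_ext fun j => by
          rw [toHom_app_π, NatTrans.comp_app, NatTrans.comp_app, Category.assoc,
            weightedHom_map_app_π, reassoc_of% p.toHom_app_π,
            ← MonoidalClosed.curry_natural_right, Category.assoc] }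

/-- The adjunction with a parameter `Hom(Φ(Y, X), F) ≃ Hom(X, MOR(K(Y, -), F))`. -/
noncomputable def parametrizedAdjunction : Φ ⊣₂ weightedHom K :=
  ParametrizedAdjunction.mk' p.adjunction (fun {Y Y'} f {X F} g => by
    simp only [adjunction, Adjunction.mkOfHomEquiv_homEquiv]
    change p.toHom _ = p.toHom _ ≫ _
    ext ⟨a⟩
    exact weightedHom_hom_ext fun j => by
      rw [toHom_app_π, NatTrans.comp_app, NatTrans.comp_app, Category.assoc,
        weightedHom_map_app_app_π, reassoc_of% p.toHom_app_π, MonoidalClosed.curry_pre_app,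
        reassoc_of% p.κ_naturality₁])

end CoendPresentation

end WeightedHom
-- The presheaves `y_M(α)` and the co-Yoneda lemma
section Yoneda

variable {A : Type v} [SmallCategory A] {M : Type u} [Category.{v} M] [MonoidalCategory M]
  [HasColimits M]

/-- The inclusion of a summand of `y_M(α)_β`. -/
noncomputable def yonedaUnitι {a : A} {b : Aᵒᵖ} (s : b.unop ⟶ a) :
    𝟙_ M ⟶ ((yonedaUnit A M).obj a).obj b :=
  Sigma.ι (fun _ : b.unop ⟶ a => 𝟙_ M) s

theorem yonedaUnitι_map {a a' : A} {b : Aᵒᵖ} (s : b.unop ⟶ a) (f : a ⟶ a') :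
    yonedaUnitι s ≫ ((yonedaUnit A M).map f).app b = yonedaUnitι (s ≫ f) := by
  exact (Sigma.ι_comp_map' _ _ _).trans (Category.id_comp _)

theorem yonedaUnitι_obj_map {a : A} {b b' : Aᵒᵖ} (s : b.unop ⟶ a) (f : b ⟶ b') :
    yonedaUnitι s ≫ ((yonedaUnit A M).obj a).map f = yonedaUnitι (M := M) (f.unop ≫ s) := by
  exact (Sigma.ι_comp_map' _ _ _).trans (Category.id_comp _)

theorem yonedaUnit_hom_ext {a : A} {b : Aᵒᵖ} (G : M ⥤ M) [G.IsLeftAdjoint] {Z : M}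
    {l l' : G.obj (((yonedaUnit A M).obj a).obj b) ⟶ Z}
    (h : ∀ s, G.map (yonedaUnitι s) ≫ l = G.map (yonedaUnitι s) ≫ l') : l = l' := by
  apply ((Adjunction.ofIsLeftAdjoint G).homEquiv _ _).injective
  refine Sigma.hom_ext _ _ fun s => ?_
  have := congrArg ((Adjunction.ofIsLeftAdjoint G).homEquiv _ _) (h s)
  rwa [Adjunction.homEquiv_naturality_left, Adjunction.homEquiv_naturality_left] at this

variable [SymmetricCategory M] [MonoidalClosed M]

theorem exists_yonedaUnit_desc (a : A) (b : Aᵒᵖ) {T Z : M} (g : (b.unop ⟶ a) → (T ⟶ Z)) :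
    ∃ l : ((yonedaUnit A M).obj a).obj b ⊗ T ⟶ Z,
      ∀ s, yonedaUnitι s ▷ T ≫ l = (λ_ T).hom ≫ g s := by
  let e {W : M} := (Adjunction.ofIsLeftAdjoint (tensorRight T)).homEquiv W Z
  refine ⟨e.symm (Sigma.desc fun s => e ((λ_ T).hom ≫ g s)), fun s => ?_⟩
  refine ((Adjunction.ofIsLeftAdjoint
    (tensorRight T)).homEquiv_naturality_left_symm _ _).symm.trans ?_
  refine (congrArg e.symm (Sigma.ι_desc _ s)).trans ?_
  exact e.symm_apply_apply _

/-- The evaluation morphism `y_M(α)_β ⊗ X_α ⟶ X_β`. -/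
noncomputable def yonedaUnitEv (X : Aᵒᵖ ⥤ M) (a : A) (b : Aᵒᵖ) :
    ((yonedaUnit A M).obj a).obj b ⊗ X.obj (op a) ⟶ X.obj b :=
  (exists_yonedaUnit_desc a b (fun s => X.map (Quiver.Hom.op s : op a ⟶ b))).choose

theorem ι_yonedaUnitEv (X : Aᵒᵖ ⥤ M) (a : A) (b : Aᵒᵖ) (s : b.unop ⟶ a) :
    yonedaUnitι s ▷ X.obj (op a) ≫ yonedaUnitEv X a b =
      (λ_ _).hom ≫ X.map (Quiver.Hom.op s : op a ⟶ b) :=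
  (exists_yonedaUnit_desc a b (fun s => X.map (Quiver.Hom.op s : op a ⟶ b))).choose_spec s

theorem yonedaUnitEv_map (X : Aᵒᵖ ⥤ M) (a : A) {b b' : Aᵒᵖ} (f : b ⟶ b') :
    ((yonedaUnit A M).obj a).map f ▷ X.obj (op a) ≫ yonedaUnitEv X a b' =
      yonedaUnitEv X a b ≫ X.map f :=
  yonedaUnit_hom_ext (tensorRight _) fun s => by
    change yonedaUnitι s ▷ _ ≫ _ = yonedaUnitι s ▷ _ ≫ _
    rw [← comp_whiskerRight_assoc, yonedaUnitι_obj_map, ι_yonedaUnitEv, reassoc_of% ι_yonedaUnitEv,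
      ← X.map_comp]
    rfl

theorem yonedaUnitEv_naturality {X X' : Aᵒᵖ ⥤ M} (g : X ⟶ X') (a : A) (b : Aᵒᵖ) :
    ((yonedaUnit A M).obj a).obj b ◁ g.app (op a) ≫ yonedaUnitEv X' a b =
      yonedaUnitEv X a b ≫ g.app b :=
  yonedaUnit_hom_ext (tensorRight _) fun s => by
    change yonedaUnitι s ▷ _ ≫ _ = yonedaUnitι s ▷ _ ≫ _
    rw [← whisker_exchange_assoc, ι_yonedaUnitEv, reassoc_of% ι_yonedaUnitEv]
    simp

theorem yonedaUnitEv_condition (X : Aᵒᵖ ⥤ M) {a a' : A} (f : a ⟶ a') (b : Aᵒᵖ) :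
    ((yonedaUnit A M).map f).app b ▷ X.obj (op a') ≫ yonedaUnitEv X a' b =
      ((yonedaUnit A M).obj a).obj b ◁ X.map f.op ≫ yonedaUnitEv X a b :=
  yonedaUnit_hom_ext (tensorRight _) fun s => by
    change yonedaUnitι s ▷ _ ≫ _ = yonedaUnitι s ▷ _ ≫ _
    rw [← comp_whiskerRight_assoc, yonedaUnitι_map, ι_yonedaUnitEv, ← whisker_exchange_assoc,
      ι_yonedaUnitEv, op_comp, X.map_comp]
    simp

/-- The co-Yoneda lemma: a functor `G` which is a left adjoint sends `X_β` to the coend of the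
objects `G(y_M(α)_β ⊗ X_α)`. -/
theorem existsUnique_yonedaUnitEv_desc (X : Aᵒᵖ ⥤ M) (b : A) (G : M ⥤ M) [G.IsLeftAdjoint]
    {Z : M} (θ : ∀ a, G.obj (((yonedaUnit A M).obj a).obj (op b) ⊗ X.obj (op a)) ⟶ Z)
    (hθ : ∀ {a a' : A} (f : a ⟶ a'),
      G.map (((yonedaUnit A M).map f).app (op b) ▷ X.obj (op a')) ≫ θ a' =
        G.map (((yonedaUnit A M).obj a).obj (op b) ◁ X.map f.op) ≫ θ a) :
    ∃! l : G.obj (X.obj (op b)) ⟶ Z, ∀ a, G.map (yonedaUnitEv X a (op b)) ≫ l = θ a := by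
  let ι : 𝟙_ M ⟶ ((yonedaUnit A M).obj b).obj (op b) := yonedaUnitι (b := op b) (𝟙 b)
  have hι {a : A} (s : b ⟶ a) : ι ≫ ((yonedaUnit A M).map s).app (op b) =
      yonedaUnitι (b := op b) s := by
    simp only [ι]
    rw [yonedaUnitι_map, Category.id_comp]
  have hη : ι ▷ X.obj (op b) ≫ yonedaUnitEv X b (op b) = (λ_ _).hom := by
    refine (ι_yonedaUnitEv X b (op b) (𝟙 b)).trans ?_
    rw [op_id, X.map_id, Category.comp_id]
  -- As in Yoneda, the map is `θ b` restricted to the summand of `𝟙 b`. The summand of `s : b ⟶ a`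
  -- is the image of that one under `y_M(s)`, and `hθ s` transfers `s` to `X`.
  refine ⟨G.map ((λ_ _).inv ≫ ι ▷ X.obj (op b)) ≫ θ b, fun a => ?_, fun l hl => ?_⟩
  · refine yonedaUnit_hom_ext (tensorRight _ ⋙ G) fun (s : b ⟶ a) => ?_
    suffices G.map (yonedaUnitι s ▷ X.obj (op a)) ≫ G.map (yonedaUnitEv X a (op b)) ≫
        G.map ((λ_ _).inv ≫ ι ▷ X.obj (op b)) ≫ θ b =
          G.map (yonedaUnitι s ▷ X.obj (op a)) ≫ θ a from this
    rw [← G.map_comp_assoc, ι_yonedaUnitEv, ← hι, comp_whiskerRight, G.map_comp_assoc (ι ▷ _), hθ s,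
      ← G.map_comp_assoc, ← G.map_comp_assoc, ← whisker_exchange, Category.assoc,
      leftUnitor_inv_naturality_assoc, Iso.hom_inv_id_assoc]
  · rw [← hl, ← G.map_comp_assoc, Category.assoc, hη, Iso.inv_hom_id, G.map_id, Category.id_comp]

end Yoneda

/-! ### Carrying the co-Yoneda relations past an extra tensor factor -/

section Monoidal

variable {M : Type u} [Category.{v} M] [MonoidalCategory M] {P P' Q Q' T T' X X' Z : M}

/-- The morphism `(P ⊗ Q) ⊗ T ⟶ P ⊗ X` induced by `e : Q ⊗ T ⟶ X`. -/
abbrev whiskerLeftAssoc (P : M) (e : Q ⊗ T ⟶ X) : (P ⊗ Q) ⊗ T ⟶ P ⊗ X :=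
  (α_ P Q T).hom ≫ P ◁ e

theorem whiskerLeftAssoc_naturality_left (p : P ⟶ P') (e : Q ⊗ T ⟶ X) :
    p ▷ Q ▷ T ≫ whiskerLeftAssoc P' e = whiskerLeftAssoc P e ≫ p ▷ X := by
  rw [associator_naturality_left_assoc, ← whisker_exchange, Category.assoc]

theorem whiskerLeftAssoc_naturality (p : P ⟶ P') {q : Q ⟶ Q'} {x : X ⟶ X'}
    {e : Q ⊗ T ⟶ X} {e' : Q' ⊗ T ⟶ X'} (h : q ▷ T ≫ e' = e ≫ x) :
    (p ▷ Q ≫ P' ◁ q) ▷ T ≫ whiskerLeftAssoc P' e' =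
      whiskerLeftAssoc P e ≫ p ▷ X ≫ P' ◁ x := by
  rw [← Category.assoc (whiskerLeftAssoc P e), ← whiskerLeftAssoc_naturality_left,
    comp_whiskerRight_assoc, Category.assoc, Category.assoc,
    associator_naturality_middle_assoc, ← whiskerLeft_comp, h, whiskerLeft_comp]

theorem whiskerLeftAssoc_naturality_right {t : T ⟶ T'} {x : X ⟶ X'}
    {e : Q ⊗ T ⟶ X} {e' : Q ⊗ T' ⟶ X'} (h : Q ◁ t ≫ e' = e ≫ x) :
    (P ⊗ Q) ◁ t ≫ whiskerLeftAssoc P e' = whiskerLeftAssoc P e ≫ P ◁ x := by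
  rw [associator_naturality_right_assoc, ← whiskerLeft_comp, h, whiskerLeft_comp, Category.assoc]

theorem whiskerLeftAssoc_condition {q : Q ⟶ Q'} {t : T' ⟶ T}
    {e : Q ⊗ T ⟶ X} {e' : Q' ⊗ T' ⟶ X} (h : q ▷ T' ≫ e' = Q ◁ t ≫ e) :
    (P ◁ q) ▷ T' ≫ whiskerLeftAssoc P e' = (P ⊗ Q) ◁ t ≫ whiskerLeftAssoc P e := by
  rw [associator_naturality_middle_assoc, ← whiskerLeft_comp, h,
    associator_naturality_right_assoc, whiskerLeft_comp]

/-- Converts the coend relation on `(P ⊗ Q) ⊗ T` into the form that co-Yoneda requires for the left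
adjoint `P ⊗ -`. -/
theorem associator_inv_condition {q : Q ⟶ Q'} {t : T' ⟶ T}
    {e : (P ⊗ Q) ⊗ T ⟶ Z} {e' : (P ⊗ Q') ⊗ T' ⟶ Z}
    (h : (P ◁ q) ▷ T' ≫ e' = (P ⊗ Q) ◁ t ≫ e) :
    P ◁ q ▷ T' ≫ (α_ P Q' T').inv ≫ e' = P ◁ Q ◁ t ≫ (α_ P Q T).inv ≫ e := by
  rw [associator_inv_naturality_middle_assoc, associator_inv_naturality_right_assoc, h]

variable [BraidedCategory M]

variable (P Q T) in
/-- The analogue of the associator where `P` is on the right. -/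
def associatorRight : (Q ⊗ P) ⊗ T ≅ (Q ⊗ T) ⊗ P :=
  α_ Q P T ≪≫ whiskerLeftIso Q (β_ P T) ≪≫ (α_ Q T P).symm

theorem associatorRight_naturality (p : P ⟶ P') (q : Q ⟶ Q') (t : T ⟶ T') :
    ((q ⊗ₘ p) ⊗ₘ t) ≫ (associatorRight P' Q' T').hom =
      (associatorRight P Q T).hom ≫ ((q ⊗ₘ t) ⊗ₘ p) := by
  simp only [associatorRight, Iso.trans_hom, whiskerLeftIso_hom, Iso.symm_hom, Category.assoc]
  rw [associator_naturality_assoc, ← associator_inv_naturality, ← id_tensorHom, ← id_tensorHom,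
    tensorHom_comp_tensorHom_assoc, tensorHom_comp_tensorHom_assoc,
    BraidedCategory.braiding_naturality, Category.id_comp, Category.comp_id]

theorem associatorRight_naturality_left (p : P ⟶ P') :
    (Q ◁ p) ▷ T ≫ (associatorRight P' Q T).hom = (associatorRight P Q T).hom ≫ (Q ⊗ T) ◁ p := by
  simpa only [id_tensorHom, tensorHom_id, id_whiskerRight] using
    associatorRight_naturality p (𝟙 Q) (𝟙 T)

theorem associatorRight_naturality_middle (q : Q ⟶ Q') :
    q ▷ P ▷ T ≫ (associatorRight P Q' T).hom = (associatorRight P Q T).hom ≫ q ▷ T ▷ P := by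
  simpa only [id_tensorHom, tensorHom_id, id_whiskerRight] using
    associatorRight_naturality (𝟙 P) q (𝟙 T)

theorem associatorRight_naturality_right (t : T ⟶ T') :
    (Q ⊗ P) ◁ t ≫ (associatorRight P Q T').hom = (associatorRight P Q T).hom ≫ (Q ◁ t) ▷ P := by
  simpa only [id_tensorHom, tensorHom_id, id_whiskerRight] using
    associatorRight_naturality (𝟙 P) (𝟙 Q) t

/-- The morphism `(Q ⊗ P) ⊗ T ⟶ X ⊗ P` induced by `e : Q ⊗ T ⟶ X`. -/
abbrev whiskerRightAssoc (P : M) (e : Q ⊗ T ⟶ X) : (Q ⊗ P) ⊗ T ⟶ X ⊗ P :=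
  (associatorRight P Q T).hom ≫ e ▷ P

theorem whiskerRightAssoc_naturality_left (p : P ⟶ P') (e : Q ⊗ T ⟶ X) :
    (Q ◁ p) ▷ T ≫ whiskerRightAssoc P' e = whiskerRightAssoc P e ≫ X ◁ p := by
  rw [reassoc_of% associatorRight_naturality_left, whisker_exchange, Category.assoc]

theorem whiskerRightAssoc_naturality (p : P ⟶ P') {q : Q ⟶ Q'} {x : X ⟶ X'}
    {e : Q ⊗ T ⟶ X} {e' : Q' ⊗ T ⟶ X'} (h : q ▷ T ≫ e' = e ≫ x) :
    (q ▷ P ≫ Q' ◁ p) ▷ T ≫ whiskerRightAssoc P' e' =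
      whiskerRightAssoc P e ≫ x ▷ P ≫ X' ◁ p := by
  rw [comp_whiskerRight_assoc, whiskerRightAssoc_naturality_left,
    Category.assoc, reassoc_of% associatorRight_naturality_middle, ← comp_whiskerRight_assoc, h,
    comp_whiskerRight_assoc, Category.assoc]

theorem whiskerRightAssoc_naturality_right {t : T ⟶ T'} {x : X ⟶ X'}
    {e : Q ⊗ T ⟶ X} {e' : Q ⊗ T' ⟶ X'} (h : Q ◁ t ≫ e' = e ≫ x) :
    (Q ⊗ P) ◁ t ≫ whiskerRightAssoc P e' = whiskerRightAssoc P e ≫ x ▷ P := by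
  rw [reassoc_of% associatorRight_naturality_right, ← comp_whiskerRight, h, comp_whiskerRight,
    Category.assoc]

theorem whiskerRightAssoc_condition {q : Q ⟶ Q'} {t : T' ⟶ T}
    {e : Q ⊗ T ⟶ X} {e' : Q' ⊗ T' ⟶ X} (h : q ▷ T' ≫ e' = Q ◁ t ≫ e) :
    q ▷ P ▷ T' ≫ whiskerRightAssoc P e' = (Q ⊗ P) ◁ t ≫ whiskerRightAssoc P e := by
  rw [reassoc_of% associatorRight_naturality_middle, ← comp_whiskerRight, h,
    reassoc_of% associatorRight_naturality_right, comp_whiskerRight]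

theorem associatorRight_inv_condition {q : Q ⟶ Q'} {t : T' ⟶ T}
    {e : (Q ⊗ P) ⊗ T ⟶ Z} {e' : (Q' ⊗ P) ⊗ T' ⟶ Z}
    (h : q ▷ P ▷ T' ≫ e' = (Q ⊗ P) ◁ t ≫ e) :
    q ▷ T' ▷ P ≫ (associatorRight P Q' T').inv ≫ e' =
      (Q ◁ t) ▷ P ≫ (associatorRight P Q T).inv ≫ e := by
  rw [← cancel_epi (associatorRight _ _ _).hom,
    ← reassoc_of% associatorRight_naturality_middle, Iso.hom_inv_id_assoc,
    ← reassoc_of% associatorRight_naturality_right, Iso.hom_inv_id_assoc, h]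

end Monoidal

/-! ### The two coend presentations of `X ⊠ Y` -/

section Presentation

variable (A : Type v) [SmallCategory A] (M : Type u) [Category.{v} M] [MonoidalCategory M]
  [HasColimits M] [SymmetricCategory M] [MonoidalClosed M]

/-- The presentation of `X ⊠ Y` as the coend of the objects `(X ⊠ y_M(α)) ⊗ Y_α`. -/
noncomputable def coendPresentationRight :
    CoendPresentation (yonedaUnit A M ⋙ (exteriorTensor A M).flip).flip (exteriorTensor A M) where
  κ Y X a j := whiskerLeftAssoc (Y.obj j.1) (yonedaUnitEv X a j.2)
  κ_map Y X a j j' f := whiskerLeftAssoc_naturality (Y.map f.1) (yonedaUnitEv_map X a f.2)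
  κ_naturality₁ f X a j := whiskerLeftAssoc_naturality_left (f.app j.1) (yonedaUnitEv X a j.2)
  κ_naturality₂ Y {X X'} g a j :=
    whiskerLeftAssoc_naturality_right (yonedaUnitEv_naturality g a j.2)
  κ_condition Y X {a b} f j := whiskerLeftAssoc_condition (yonedaUnitEv_condition X f j.2)
  existsUnique_desc Y X j {Z} θ hθ := by
    obtain ⟨l, hl, hl'⟩ := existsUnique_yonedaUnitEv_desc X j.2.unop (tensorLeft (Y.obj j.1))
      (fun a => (α_ _ _ _).inv ≫ θ a) (fun {a a'} f => associator_inv_condition (hθ f))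
    refine ⟨l, fun a => ?_, fun l' hl₁ => hl' l' fun a => ?_⟩
    · exact (Category.assoc _ _ _).trans ((Iso.eq_inv_comp _).1 (hl a))
    · exact (Iso.eq_inv_comp _).2 ((Category.assoc _ _ _).symm.trans (hl₁ a))

/-- The presentation of `X ⊠ Y` as the coend of the objects `(y_M(α) ⊠ Y) ⊗ X_α`. -/
noncomputable def coendPresentationLeft :
    CoendPresentation (yonedaUnit A M ⋙ exteriorTensor A M).flip (exteriorTensor A M).flip where
  κ Y X a j := whiskerRightAssoc (Y.obj j.2) (yonedaUnitEv X a j.1)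
  κ_map Y X a j j' f := whiskerRightAssoc_naturality (Y.map f.2) (yonedaUnitEv_map X a f.1)
  κ_naturality₁ f X a j := whiskerRightAssoc_naturality_left (f.app j.2) (yonedaUnitEv X a j.1)
  κ_naturality₂ Y {X X'} g a j :=
    whiskerRightAssoc_naturality_right (yonedaUnitEv_naturality g a j.1)
  κ_condition Y X {a b} f j := whiskerRightAssoc_condition (yonedaUnitEv_condition X f j.1)
  existsUnique_desc Y X j {Z} θ hθ := by
    obtain ⟨l, hl, hl'⟩ := existsUnique_yonedaUnitEv_desc X j.1.unop (tensorRight (Y.obj j.2))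
      (fun a => (associatorRight _ (((yonedaUnit A M).obj a).obj j.1) _).inv ≫ θ a)
      (fun {a a'} f => associatorRight_inv_condition (hθ f))
    refine ⟨l, fun a => ?_, fun l' hl₁ => hl' l' fun a => ?_⟩
    · exact (Category.assoc _ _ _).trans ((Iso.eq_inv_comp _).1 (hl a))
    · exact (Iso.eq_inv_comp _).2 ((Category.assoc _ _ _).symm.trans (hl₁ a))

end Presentation

end ReedyExterior

theorem mainTheorem6 {A : Type v} [SmallCategory A] {W₁ W₂ : MorphismProperty A}
    [W₁.IsMultiplicative] [W₂.IsMultiplicative]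
    {α : Type w} [LinearOrder α] [OrderBot α] [SuccOrder α] [WellFoundedLT α]
    (r : ReedyStructure W₁ W₂ α)
    (M : Type u) [Category.{v} M] [HasLimits M] [HasColimits M]
    [MonoidalCategory M] [SymmetricCategory M] [MonoidalClosed M] [ModelCategory M]
    (hM : ReedyExterior.IsSymmetricMonoidalModelCategory M) :
    ReedyExterior.IsQuillenAdjunctionOfTwoVariables
      (ReedyExterior.reedyModelClasses r.op M)
      (ReedyExterior.reedyModelClasses r.op M)
      (ReedyExterior.reedyModelClasses (r.op.prod r.op) M)
      (ReedyExterior.exteriorTensor A M)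
      (ReedyExterior.exteriorMORLeft A M)
      (ReedyExterior.exteriorMORRight A M) where
  adjunction₁ := ⟨(ReedyExterior.coendPresentationLeft A M).parametrizedAdjunction⟩
  adjunction₂ := ⟨(ReedyExterior.coendPresentationRight A M).parametrizedAdjunction⟩
  pushoutProduct := ReedyExterior.exteriorTensor_pushoutProductAxiom hM.pushoutProduct r.op r.op
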